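/- Let $S^2$ be the unit sphere of $\mathbb{R}^3$ with the spherical (angular) distance $|ab|$. A set $C\subset S^2$ is convex if it contains no pair of antipodes and contains, with any two points $a,b$, the shorter great-circle arc $ab$; a convex body is a closed convex set with non-empty interior, and a convex polygon is a convex body which is the convex hull of finitely many points of an open hemisphere. The disk of radius $\rho\in(0,\frac{\pi}{2}]$ centered at $p$ is $\{x\in S^2 : |px|\le\rho\}$; a hemisphere is a disk of radius $\frac{\pi}{2}$. A hemisphere $K$ supports a convex body $C$ if $C\subset K$ and $\mathrm{bd}(C)\cap \mathrm{bd}(K)\neq\emptyset$. A lune is the intersection $G\cap H$ of two different, non-opposite hemispheres, and its thickness is the spherical distance of the centers of the two semicircles $\mathrm{bd}(G)\cap H$ and $\mathrm{bd}(H)\cap G$ bounding it. For a hemisphere $K$ supporting $C$, the width of $C$ determined by $K$ is the minimum thickness of a lune $K\cap K'$ over all hemispheres $K'$ supporting $C$; the thickness $\Delta(C)$ is the smallest width of $C$ over all supporting hemispheres $K$. A convex body $R$ is reduced if $\Delta(K)<\Delta(R)$ for every convex body $K\subsetneq R$. Theorem. Let $V\subset S^2$ be a reduced convex polygon. Then $0<\Delta(V)\le\frac{\pi}{2}$,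 and $V$ is contained in the disk of radius $\Delta(V)$ centered at some boundary point of $V$. -/

import Mathlib

namespace SphericalPolygon

/-- The Euclidean space of dimension three. -/
abbrev E3 : Type := EuclideanSpace ℝ (Fin 3)

/-- The unit sphere `S²`, with its subspace topology. -/
abbrev S2 : Type := Metric.sphere (0 : E3) 1

/-- Spherical distance: the length of the shorter great-circle arc joining the points. -/
noncomputable def sdist (x y : S2) : ℝ := InnerProductGeometry.angle (x : E3) (y : E3)

/-- The closed disk with center `p` and radius `ρ`. -/
def disk (p : S2) (ρ : ℝ) : Set S2 := {x | sdist p x ≤ ρ}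

/-- The hemisphere with center `m`. -/
def hemisphere (m : S2) : Set S2 := disk m (Real.pi / 2)

/-- The arc `ab`: the part of the sphere in the convex cone spanned by `a` and `b`. For distinct
non-antipodal `a`, `b` it is the shorter of the two arcs of the great circle through them. -/
def arc (a b : S2) : Set S2 :=
  {x | ∃ s t : ℝ, 0 ≤ s ∧ 0 ≤ t ∧ (x : E3) = s • (a : E3) + t • (b : E3)}

/-- Convex subsets of the sphere: no antipodes, and all connecting arcs are contained. -/
def IsConvex (C : Set S2) : Prop :=
  (∀ a ∈ C, -a ∉ C) ∧ ∀ a ∈ C, ∀ b ∈ C, arc a b ⊆ C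

/-- A convex body: a closed convex set with non-empty interior. -/
def IsConvexBody (C : Set S2) : Prop :=
  IsConvex C ∧ IsClosed C ∧ (interior C).Nonempty

/-- The convex hull, meant for subsets of an open hemisphere. -/
def hull (A : Set S2) : Set S2 := ⋂₀ {C | IsConvex C ∧ A ⊆ C}

/-- A convex polygon: a convex body that is the convex hull of finitely many points of an open
hemisphere. -/
def IsPolygon (V : Set S2) : Prop :=
  IsConvexBody V ∧ ∃ F : Set S2, F.Finite ∧
    (∃ m : S2, ∀ x ∈ F, sdist m x < Real.pi / 2) ∧ V = hull F

/-- The hemisphere with center `m` supports `C`. -/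
def Supports (m : S2) (C : Set S2) : Prop :=
  C ⊆ hemisphere m ∧ (frontier C ∩ frontier (hemisphere m)).Nonempty

/-- The hemispheres with centers `g` and `h` are different and not opposite, so that their
intersection is a lune. -/
def IsLunePair (g h : S2) : Prop := g ≠ h ∧ g ≠ -h

/-- The center of the semicircle `G/H`, the part in `H` of the great circle bounding `G`, where
`G` and `H` are the hemispheres with centers `g` and `h`: the normalized projection of `h` to the
plane of that great circle (see `luneCenter_spec`). -/
noncomputable def luneCenter (g h : S2) : E3 :=
  ‖(h : E3) - (inner ℝ (g : E3) (h : E3)) • (g : E3)‖⁻¹ •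
    ((h : E3) - (inner ℝ (g : E3) (h : E3)) • (g : E3))

/-- For a lune, `luneCenter g h` is a point of the sphere on the great circle bounding the
hemisphere of `g`, and the semicircle `G/H` consists of the points of this great circle at
distance at most `π / 2` from it. -/
theorem luneCenter_spec {g h : S2} (hgh : IsLunePair g h) :
    ∃ c : S2, (c : E3) = luneCenter g h ∧ sdist g c = Real.pi / 2 ∧
      ∀ x : S2, sdist g x = Real.pi / 2 → (x ∈ hemisphere h ↔ sdist c x ≤ Real.pi / 2) := by
  have hg : ‖(g : E3)‖ = 1 := by simp
  have hh : ‖(h : E3)‖ = 1 := by simp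
  set w : E3 := (h : E3) - (inner ℝ (g : E3) (h : E3)) • (g : E3) with hw
  have hw0 : w ≠ 0 := by
    intro h0
    have e : (h : E3) = (inner ℝ (g : E3) (h : E3)) • (g : E3) := sub_eq_zero.mp h0
    have e2 := congrArg norm e
    rw [norm_smul, hg, hh, mul_one, Real.norm_eq_abs] at e2
    rcases (abs_eq zero_le_one).mp e2.symm with e3 | e3
    · rw [e3, one_smul] at e
      exact hgh.1 (Subtype.ext e.symm)
    · rw [e3, neg_one_smul] at e
      exact hgh.2 (Subtype.ext (by simp [e]))
  have hwn : 0 < ‖w‖⁻¹ := inv_pos.mpr (norm_pos_iff.mpr hw0)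
  have hc : ‖luneCenter g h‖ = 1 := by
    rw [luneCenter, ← hw, norm_smul, norm_inv, norm_norm,
      inv_mul_cancel₀ (norm_ne_zero_iff.mpr hw0)]
  have hgw : inner ℝ (g : E3) w = 0 := by
    rw [hw, inner_sub_right, inner_smul_right, real_inner_self_eq_norm_sq, hg]
    ring
  refine ⟨⟨luneCenter g h, by simpa using hc⟩, rfl, ?_, ?_⟩
  · refine (InnerProductGeometry.inner_eq_zero_iff_angle_eq_pi_div_two _ _).mp ?_
    change inner ℝ (g : E3) (luneCenter g h) = 0
    rw [luneCenter, ← hw, inner_smul_right, hgw, mul_zero]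
  · intro x hx
    have hgx : inner ℝ (g : E3) (x : E3) = 0 :=
      (InnerProductGeometry.inner_eq_zero_iff_angle_eq_pi_div_two _ _).mpr hx
    change InnerProductGeometry.angle (h : E3) (x : E3) ≤ _ ↔
      InnerProductGeometry.angle (luneCenter g h) (x : E3) ≤ _
    rw [luneCenter, ← hw, InnerProductGeometry.angle_smul_left_of_pos _ _ hwn,
      InnerProductGeometry.angle, InnerProductGeometry.angle, Real.arccos_le_pi_div_two,
      Real.arccos_le_pi_div_two]
    have hx1 : ‖(x : E3)‖ = 1 := by simp
    have e : inner ℝ w (x : E3) = inner ℝ (h : E3) (x : E3) := by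
      rw [hw, inner_sub_left, inner_smul_left, hgx]
      simp
    rw [e, hh, hx1, mul_one, mul_one, div_one, le_div_iff₀ (norm_pos_iff.mpr hw0), zero_mul]

/-- The thickness of the lune bounded by the hemispheres with centers `g` and `h`: the spherical
distance of the centers of its two bounding semicircles. -/
noncomputable def luneThickness (g h : S2) : ℝ :=
  InnerProductGeometry.angle (luneCenter g h) (luneCenter h g)

/-- The width of `C` determined by the supporting hemisphere with center `k`: the minimal
thickness of a lune cut out by it and another supporting hemisphere. -/
noncomputable def width (C : Set S2) (k : S2) : ℝ :=
  sInf {t | ∃ h : S2, Supports h C ∧ IsLunePair k h ∧ t = luneThickness k h}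

/-- The thickness of `C`: its smallest width. -/
noncomputable def thickness (C : Set S2) : ℝ :=
  sInf {t | ∃ k : S2, Supports k C ∧ t = width C k}

/-- A convex body is reduced if every convex body properly contained in it has smaller
thickness. -/
def IsReduced (R : Set S2) : Prop :=
  IsConvexBody R ∧ ∀ K : Set S2, IsConvexBody K → K ⊂ R → thickness K < thickness R

end SphericalPolygon

namespace SphericalPolygon

open Filter Topology MeasureTheory
open scoped ENNReal

/-! The polar of a body is the set of centers of hemispheres containing it. A lune with hemisphere
centers `g`, `h` has thickness `π - |gh|`, so `Δ(V)` is `π` minus the diameter of the polar. If `c`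
is the least inner product of two polar points, then `cos Δ(V) = -c =: κ`. The first order
conditions for a farthest pair, combined with the bipolar theorem, put the centers of both
semicircles of a thinnest lune into `V` (`IsFarthestPair.exists_center`).

Reducedness enters at the vertices. Cutting a small cap off at a vertex lowers the thickness, and a
thinnest lune of the remainder has a semicircle center on the cut. In the limit every vertex `v i`
is a semicircle center of a thinnest lune of `V`, with opposite center `t i`
(`IsReduced.exists_lune`). Since a vertex has more than one supporting hemisphere, `c ≤ 0`, that is,
`Δ(V) ≤ π / 2`.

The arcs `v i t i` have the common length `Δ(V)`, and no great circle separates two of them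
(`not_separated`). Suppose every `t i` had a vertex `v (f i)` farther away than `Δ(V)`. On its
periodic points `f` is a permutation. Because no great circle has arcs on both of its sides,
rematching `t i` with `v (f i)` cannot increase the number of pairs it separates. Integrated over
all great circles this contradicts `volume_separating_lt`: the measure of circles separating two
points grows strictly with their distance. So some `t i` has all vertices within `Δ(V)`
(`exists_forall_le_inner`). A disk of radius at most `π / 2` contains `V` once it contains the
vertices, and `t i` is a boundary point. -/

/-! ### Inner products, hemispheres and interior points. -/

theorem inner_self_sphere (x : S2) : inner ℝ (x : E3) (x : E3) = 1 := by
  rw [real_inner_self_eq_norm_sq]; simp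

theorem inner_lt_one {x y : S2} (h : x ≠ y) : inner ℝ (x : E3) (y : E3) < 1 :=
  (inner_lt_one_iff_real_of_norm_eq_one (by simp) (by simp)).2 fun e => h (Subtype.ext e)

theorem neg_one_lt_inner {x y : S2} (h : x ≠ -y) : -1 < inner ℝ (x : E3) (y : E3) := by
  have := inner_lt_one h
  rw [show ((-y : S2) : E3) = -(y : E3) from rfl, inner_neg_right] at this
  linarith

theorem sdist_eq (x y : S2) : sdist x y = Real.arccos (inner ℝ (x : E3) (y : E3)) := by
  simp [sdist, InnerProductGeometry.angle]

theorem mem_hemisphere {m x : S2} : x ∈ hemisphere m ↔ 0 ≤ inner ℝ (m : E3) (x : E3) := by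
  change sdist m x ≤ _ ↔ _
  rw [sdist_eq, Real.arccos_le_pi_div_two]

/-- Every nonzero vector is a positive multiple of a point of the sphere. -/
theorem exists_sphere_smul {z : E3} (hz : z ≠ 0) : ∃ y : S2, z = ‖z‖ • (y : E3) := by
  have h : ‖z‖ ≠ 0 := norm_ne_zero_iff.mpr hz
  refine ⟨⟨‖z‖⁻¹ • z, by simp [norm_smul, h]⟩, ?_⟩
  simp [smul_smul, h]

/-- Vectors close to an interior point of a subset of the sphere are positive multiples of points
of this subset. -/
theorem eventually_smul_mem {A : Set S2} {x : S2} (hx : x ∈ interior A) :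
    ∀ᶠ z in 𝓝 (x : E3), ∃ y ∈ A, ∃ r : ℝ, 0 < r ∧ z = r • (y : E3) := by
  obtain ⟨U, hU, hUA⟩ := isOpen_induced_iff.mp (isOpen_interior (s := A))
  have hxn : ‖(x : E3)‖ = 1 := by simp
  have hx0 : (x : E3) ≠ 0 := by
    intro h; rw [h, norm_zero] at hxn; exact zero_ne_one hxn
  have hc : ContinuousAt (fun z : E3 => ‖z‖⁻¹ • z) (x : E3) :=
    (continuousAt_id.norm.inv₀ (by simp)).smul continuousAt_id
  have hxU : (x : E3) ∈ U := by
    have : x ∈ Subtype.val ⁻¹' U := by rw [hUA]; exact hx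
    exact this
  have h1 : ∀ᶠ z in 𝓝 (x : E3), ‖z‖⁻¹ • z ∈ U := by
    apply hc.eventually (hU.mem_nhds _)
    simpa using hxU
  filter_upwards [h1, isOpen_ne.mem_nhds hx0] with z hz hz0
  obtain ⟨y, hy⟩ := exists_sphere_smul hz0
  have hzn : 0 < ‖z‖ := norm_pos_iff.mpr hz0
  refine ⟨y, interior_subset ?_, ‖z‖, hzn, hy⟩
  rw [← hUA]
  change (y : E3) ∈ U
  convert hz using 1
  conv_rhs => rw [hy]
  simp [norm_smul, smul_smul, hzn.ne']

/-- Moving from `x` in the direction `-m` leaves the hemisphere of `m` at once. -/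
theorem notMem_interior {A : Set S2} {m x : S2} (hA : ∀ y ∈ A, 0 ≤ inner ℝ (m : E3) (y : E3))
    (hx : inner ℝ (m : E3) (x : E3) = 0) : x ∉ interior A := by
  intro h
  have hc : Tendsto (fun ε : ℝ => (x : E3) - ε • (m : E3)) (𝓝[>] 0) (𝓝 (x : E3)) := by
    have : Continuous fun ε : ℝ => (x : E3) - ε • (m : E3) := by fun_prop
    have h2 := this.tendsto 0
    simp only [zero_smul, sub_zero] at h2
    exact h2.mono_left nhdsWithin_le_nhds
  obtain ⟨ε, ⟨y, hy, r, hr, e⟩, hε⟩ :=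
    ((hc.eventually (eventually_smul_mem h)).and self_mem_nhdsWithin).exists
  have e2 := congrArg (fun z => inner ℝ (m : E3) z) e
  simp only [inner_sub_right, inner_smul_right, hx, inner_self_sphere] at e2
  have := mul_nonneg hr.le (hA y hy)
  have hε' : (0 : ℝ) < ε := hε
  linarith

/-! ### The polar and the thickness of lunes. -/

/-- The centers of the hemispheres containing `C`. -/
def polar (C : Set S2) : Set S2 := {k | ∀ x ∈ C, 0 ≤ inner ℝ (k : E3) (x : E3)}

theorem isClosed_polar (C : Set S2) : IsClosed (polar C) := by
  have : polar C = ⋂ x ∈ C, {k : S2 | 0 ≤ inner ℝ (k : E3) (x : E3)} := by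
    ext k; simp [polar]
  rw [this]
  refine isClosed_biInter fun x _ => isClosed_le continuous_const ?_
  fun_prop

theorem Supports.mem_polar {C : Set S2} {m : S2} (h : Supports m C) : m ∈ polar C :=
  fun _ hx => mem_hemisphere.mp (h.1 hx)

theorem supports_of_mem_polar {C : Set S2} {m x : S2} (hm : m ∈ polar C) (hx : x ∈ C)
    (h0 : inner ℝ (m : E3) (x : E3) = 0) : Supports m C :=
  ⟨fun y hy => mem_hemisphere.mpr (hm y hy), x,
    ⟨subset_closure hx, notMem_interior hm h0⟩,
    ⟨subset_closure (mem_hemisphere.mpr h0.ge),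
      notMem_interior (fun _ hy => mem_hemisphere.mp hy) h0⟩⟩

theorem inner_pos_of_mem_interior {C : Set S2} {k x : S2} (hk : k ∈ polar C)
    (hx : x ∈ interior C) : 0 < inner ℝ (k : E3) (x : E3) :=
  lt_of_le_of_ne (hk x (interior_subset hx)) fun h => notMem_interior hk h.symm hx

theorem ne_neg_of_mem_polar {C : Set S2} (hC : (interior C).Nonempty) {g h : S2}
    (hg : g ∈ polar C) (hh : h ∈ polar C) : g ≠ -h := by
  rintro rfl
  obtain ⟨x, hx⟩ := hC
  have h1 := inner_pos_of_mem_interior hg hx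
  have h2 := inner_pos_of_mem_interior hh hx
  rw [show ((-h : S2) : E3) = -(h : E3) from rfl, inner_neg_left] at h1
  linarith

/-- The two projections defining the semicircle centers both have squared length `1 - c ^ 2`, and
their inner product is `-c * (1 - c ^ 2)`; so the cosine of the thickness is `-c`. -/
theorem luneThickness_eq {g h : S2} (hgh : IsLunePair g h) :
    luneThickness g h = Real.pi - Real.arccos (inner ℝ (g : E3) (h : E3)) := by
  set c := inner ℝ (g : E3) (h : E3) with hc
  have h1 : c < 1 := inner_lt_one hgh.1
  have h2 : -1 < c := neg_one_lt_inner hgh.2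
  have hs : 0 < 1 - c ^ 2 := by nlinarith
  have hc' : inner ℝ (h : E3) (g : E3) = c := real_inner_comm _ _
  have n1 : ‖(h : E3) - c • (g : E3)‖ ^ 2 = 1 - c ^ 2 := by
    rw [← real_inner_self_eq_norm_sq]
    simp only [inner_sub_left, inner_sub_right, inner_smul_left, inner_smul_right,
      inner_self_sphere, hc', ← hc, conj_trivial]
    ring
  have n2 : ‖(g : E3) - c • (h : E3)‖ ^ 2 = 1 - c ^ 2 := by
    rw [← real_inner_self_eq_norm_sq]
    simp only [inner_sub_left, inner_sub_right, inner_smul_left, inner_smul_right,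
      inner_self_sphere, hc', ← hc, conj_trivial]
    ring
  have p1 : 0 < ‖(h : E3) - c • (g : E3)‖ := by
    by_contra! h0
    nlinarith [norm_nonneg ((h : E3) - c • (g : E3))]
  have n3 : ‖(h : E3) - c • (g : E3)‖ = ‖(g : E3) - c • (h : E3)‖ := by
    rw [← sq_eq_sq₀ (norm_nonneg _) (norm_nonneg _), n1, n2]
  have p2 := n3 ▸ p1
  rw [luneThickness, luneCenter, luneCenter, hc', ← hc,
    InnerProductGeometry.angle_smul_left_of_pos _ _ (inv_pos.mpr p1),
    InnerProductGeometry.angle_smul_right_of_pos _ _ (inv_pos.mpr p2),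
    InnerProductGeometry.angle, ← n3, ← sq, n1, ← Real.arccos_neg]
  congr 1
  simp only [inner_sub_left, inner_sub_right, inner_smul_left, inner_smul_right,
    inner_self_sphere, hc', ← hc, conj_trivial]
  field_simp
  ring

/-! ### First order conditions and the bipolar theorem. -/

/-- First order condition at a point `h` of a set of directions which minimizes `⟪k, ·⟫`. -/
theorem inner_ge_of_minimizer {P : Set S2} {h : S2} {k w : E3} {c : ℝ}
    (hc : inner ℝ k (h : E3) = c) (hmin : ∀ y ∈ P, c ≤ inner ℝ k (y : E3))
    (hw : ∀ᶠ ε in 𝓝[>] (0 : ℝ), ∃ y ∈ P, ∃ r : ℝ, 0 < r ∧ (h : E3) + ε • w = r • (y : E3)) :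
    c * inner ℝ (h : E3) w ≤ inner ℝ k w := by
  by_contra! hlt
  set d := c * inner ℝ (h : E3) w - inner ℝ k w with hd
  have hd0 : 0 < d := by linarith
  have hlim : Tendsto (fun ε : ℝ => ε * (|c| * ‖w‖ ^ 2)) (𝓝[>] 0) (𝓝 0) := by
    have : Continuous fun ε : ℝ => ε * (|c| * ‖w‖ ^ 2) := by fun_prop
    have h2 := this.tendsto 0
    simp only [zero_mul] at h2
    exact h2.mono_left nhdsWithin_le_nhds
  obtain ⟨ε, ⟨⟨y, hy, r, hr, e⟩, hε⟩, hεd⟩ := ((hw.and self_mem_nhdsWithin).and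
    (hlim.eventually (gt_mem_nhds hd0))).exists
  replace hε : (0 : ℝ) < ε := hε
  have hn : ‖(h : E3) + ε • w‖ = r := by rw [e, norm_smul]; simp [abs_of_pos hr]
  have hn2 : r ^ 2 = 1 + 2 * ε * inner ℝ (h : E3) w + ε ^ 2 * ‖w‖ ^ 2 := by
    rw [← hn, norm_add_sq_real, norm_smul, inner_smul_right, mul_pow]
    simp
    ring
  -- The norm `r` equals `1 + ε⟪h, w⟫` up to second order. Both bounds are needed because the sign
  -- of `c` is unknown.
  have hlow : 1 + ε * inner ℝ (h : E3) w ≤ r := by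
    have := real_inner_le_norm (h : E3) ((h : E3) + ε • w)
    rw [hn, inner_add_right, inner_smul_right, inner_self_sphere] at this
    simpa using this
  have hup : r ≤ 1 + ε * inner ℝ (h : E3) w + ε ^ 2 * ‖w‖ ^ 2 / 2 := by
    nlinarith [sq_nonneg (r - 1)]
  have e2 : c + ε * inner ℝ k w = r * inner ℝ k (y : E3) := by
    have := congrArg (fun z => inner ℝ k z) e
    simpa only [inner_add_right, inner_smul_right, hc] using this
  have h1 : r * c ≤ c + ε * inner ℝ k w := by
    rw [e2]; exact mul_le_mul_of_nonneg_left (hmin y hy) hr.le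
  have h3 : c * (1 + ε * inner ℝ (h : E3) w) - |c| * (ε ^ 2 * ‖w‖ ^ 2 / 2) ≤ r * c := by
    set q := r - (1 + ε * inner ℝ (h : E3) w) with hq
    have hq0 : 0 ≤ q := by linarith
    have hq1 : q ≤ ε ^ 2 * ‖w‖ ^ 2 / 2 := by linarith
    have : -(|c| * (ε ^ 2 * ‖w‖ ^ 2 / 2)) ≤ c * q := by
      have a1 : |c * q| ≤ |c| * (ε ^ 2 * ‖w‖ ^ 2 / 2) := by
        rw [abs_mul, abs_of_nonneg hq0]; exact mul_le_mul_of_nonneg_left hq1 (abs_nonneg c)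
      linarith [neg_abs_le (c * q)]
    have e3 : r = q + (1 + ε * inner ℝ (h : E3) w) := by rw [hq]; ring
    rw [e3]; linarith
  have h4 : ε * d ≤ ε * (ε * (|c| * ‖w‖ ^ 2) / 2) := by rw [hd]; linarith
  have h5 := le_of_mul_le_mul_left h4 hε
  have h6 : 0 ≤ ε * (|c| * ‖w‖ ^ 2) := by positivity
  linarith

theorem IsConvex.exists_smul {C : Set S2} (hC : IsConvex C) {a b : S2} (ha : a ∈ C) (hb : b ∈ C)
    {s t : ℝ} (hs : 0 ≤ s) (ht : 0 ≤ t) (hst : 0 < s + t) :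
    ∃ y ∈ C, ∃ r : ℝ, 0 < r ∧ s • (a : E3) + t • (b : E3) = r • (y : E3) := by
  have h0 : s • (a : E3) + t • (b : E3) ≠ 0 := by
    intro h
    have h1 : s • (a : E3) = -(t • (b : E3)) := eq_neg_of_add_eq_zero_left h
    have h2 : s = t := by
      have := congrArg norm h1
      simpa [norm_smul, abs_of_nonneg hs, abs_of_nonneg ht] using this
    subst h2
    have h3 : (a : E3) = -(b : E3) := by
      have : s • ((a : E3) + b) = 0 := by rw [smul_add]; exact h
      rcases smul_eq_zero.mp this with h | h
      · linarith
      · exact eq_neg_of_add_eq_zero_left h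
    have : b = -a := Subtype.ext (by simp [h3])
    exact hC.1 a ha (this ▸ hb)
  obtain ⟨y, hy⟩ := exists_sphere_smul h0
  set n := ‖s • (a : E3) + t • (b : E3)‖
  have hn : 0 < n := norm_pos_iff.mpr h0
  refine ⟨y, hC.2 a ha b hb ⟨n⁻¹ * s, n⁻¹ * t, by positivity, by positivity, ?_⟩, n, hn, hy⟩
  rw [mul_smul, mul_smul, ← smul_add, hy, smul_smul, inv_mul_cancel₀ hn.ne', one_smul]

/-- The bipolar theorem on the sphere. -/
theorem exists_smul_of_inner_polar_nonneg {C : Set S2} (hC : IsConvex C) (hcl : IsClosed C)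
    (hne : C.Nonempty) {z : E3} (hz : ∀ k ∈ polar C, 0 ≤ inner ℝ (k : E3) z) :
    ∃ y ∈ C, z = ‖z‖ • (y : E3) := by
  let S : Set E3 := Prod.fst '' {p : E3 × S2 | p.2 ∈ C ∧ p.1 = ‖p.1‖ • (p.2 : E3)}
  -- The cone over `C` is the projection of a closed set along the compact sphere.
  have hS : IsClosed S := by
    refine isClosedMap_fst_of_compactSpace _ (IsClosed.inter (hcl.preimage continuous_snd) ?_)
    exact isClosed_eq (by fun_prop) (by fun_prop)
  have hmem : ∀ {r : ℝ} {y : S2}, 0 ≤ r → y ∈ C → r • (y : E3) ∈ S := fun {r y} hr hy =>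
    ⟨(r • (y : E3), y), ⟨hy, by simp [norm_smul, abs_of_nonneg hr]⟩, rfl⟩
  let K : ProperCone ℝ E3 :=
    { carrier := S
      zero_mem' := by
        obtain ⟨y, hy⟩ := hne
        simpa using hmem le_rfl hy
      add_mem' := by
        rintro _ _ ⟨⟨a, x⟩, ⟨hx, ea⟩, rfl⟩ ⟨⟨b, y⟩, ⟨hy, eb⟩, rfl⟩
        dsimp only at *
        rw [ea, eb]
        rcases (add_nonneg (norm_nonneg a) (norm_nonneg b)).eq_or_lt with h | h
        · have h1 : ‖a‖ = 0 := by linarith [norm_nonneg a, norm_nonneg b]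
          have h2 : ‖b‖ = 0 := by linarith [norm_nonneg a, norm_nonneg b]
          rw [h1, h2, zero_smul, zero_smul, add_zero]
          simpa using hmem le_rfl hx
        · obtain ⟨u, hu, r, hr, e⟩ := hC.exists_smul hx hy (norm_nonneg a) (norm_nonneg b) h
          rw [e]; exact hmem hr.le hu
      smul_mem' := by
        rintro r _ ⟨⟨a, x⟩, ⟨hx, ea⟩, rfl⟩
        dsimp only at *
        rw [ea]
        change (r : ℝ) • (‖a‖ • (x : E3)) ∈ S
        rw [smul_smul]
        exact hmem (mul_nonneg r.2 (norm_nonneg a)) hx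
      isClosed' := hS }
  have hzS : z ∈ S := by
    by_contra hn
    obtain ⟨y, hy, hyz⟩ := ProperCone.hyperplane_separation' K (x₀ := z) hn
    have hy0 : y ≠ 0 := by rintro rfl; simp at hyz
    obtain ⟨k, hk⟩ := exists_sphere_smul hy0
    have hn0 : 0 < ‖y‖ := norm_pos_iff.mpr hy0
    have hkp : k ∈ polar C := by
      intro x hx
      have h1 := hy (x : E3) (show (x : E3) ∈ S by simpa using hmem zero_le_one hx)
      rw [hk, inner_smul_right, real_inner_comm] at h1
      exact nonneg_of_mul_nonneg_right h1 hn0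
    have h2 := hz k hkp
    rw [hk, inner_smul_right, real_inner_comm] at hyz
    nlinarith
  obtain ⟨⟨a, x⟩, ⟨hx, ea⟩, rfl⟩ := hzS
  exact ⟨x, hx, ea⟩

/-- Two vectors of the space have a common nonzero orthogonal vector. -/
theorem exists_orthogonal (a b : E3) : ∃ w : E3, w ≠ 0 ∧ inner ℝ a w = 0 ∧ inner ℝ b w = 0 := by
  have h1 : Module.finrank ℝ (Submodule.span ℝ ({a, b} : Set E3)) ≤ 2 := by
    classical
    have := finrank_span_finset_le_card (R := ℝ) ({a, b} : Finset E3)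
    simp only [Finset.coe_insert, Finset.coe_singleton] at this
    exact this.trans Finset.card_le_two
  have h2 := Submodule.finrank_add_finrank_orthogonal (Submodule.span ℝ ({a, b} : Set E3))
  have h3 : Module.finrank ℝ E3 = 3 := by simp
  have h4 : (Submodule.span ℝ ({a, b} : Set E3))ᗮ ≠ ⊥ := by
    intro h
    rw [h, finrank_bot] at h2
    omega
  obtain ⟨w, hw, hw0⟩ := Submodule.exists_mem_ne_zero_of_ne_bot h4
  rw [Submodule.mem_orthogonal] at hw
  exact ⟨w, hw0, hw a (Submodule.subset_span (by simp)), hw b (Submodule.subset_span (by simp))⟩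

/-- Small perturbations of a functional that is positive on a compact set are multiples of points
of the polar. -/
theorem eventually_smul_mem_polar {C : Set S2} (hcl : IsClosed C) (hne : C.Nonempty) {m : E3}
    (hm : ∀ x ∈ C, 0 < inner ℝ m (x : E3)) (w : E3) :
    ∀ᶠ ε in 𝓝[>] (0 : ℝ), ∃ y ∈ polar C, ∃ r : ℝ, 0 < r ∧ m + ε • w = r • (y : E3) := by
  obtain ⟨x₀, hx₀, hmin⟩ := hcl.isCompact.exists_isMinOn hne
    (f := fun x : S2 => inner ℝ m (x : E3)) (by fun_prop)
  have hlim : Tendsto (fun ε : ℝ => ε * ‖w‖) (𝓝[>] 0) (𝓝 0) := by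
    have : Continuous fun ε : ℝ => ε * ‖w‖ := by fun_prop
    have h2 := this.tendsto 0
    simp only [zero_mul] at h2
    exact h2.mono_left nhdsWithin_le_nhds
  filter_upwards [hlim.eventually (gt_mem_nhds (hm x₀ hx₀)), self_mem_nhdsWithin] with ε hε hε0
  replace hε0 : (0 : ℝ) < ε := hε0
  have hpos : ∀ x ∈ C, 0 < inner ℝ (m + ε • w) (x : E3) := by
    intro x hx
    have h1 : inner ℝ m (x₀ : E3) ≤ inner ℝ m (x : E3) := hmin hx
    have h2 := neg_le_of_abs_le (abs_real_inner_le_norm w (x : E3))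
    simp only [norm_eq_of_mem_sphere, mul_one] at h2
    rw [inner_add_left, inner_smul_left, conj_trivial]
    nlinarith
  have h0 : m + ε • w ≠ 0 := by
    intro h
    have := hpos x₀ hx₀
    rw [h, inner_zero_left] at this
    exact lt_irrefl _ this
  obtain ⟨y, hy⟩ := exists_sphere_smul h0
  have hn : 0 < ‖m + ε • w‖ := norm_pos_iff.mpr h0
  refine ⟨y, fun x hx => ?_, _, hn, hy⟩
  have := hpos x hx
  rw [hy, inner_smul_left, conj_trivial] at this
  exact (pos_of_mul_pos_right this hn.le).le

/-- The polar is not a single point, so its point farthest from `k` differs from `k`. -/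
theorem exists_mem_polar_ne {C : Set S2} (hcl : IsClosed C) (hne : C.Nonempty) {m : E3}
    (hm : ∀ x ∈ C, 0 < inner ℝ m (x : E3)) (k : S2) : ∃ y ∈ polar C, y ≠ k := by
  obtain ⟨w, hw0, hw, -⟩ := exists_orthogonal (k : E3) (k : E3)
  obtain ⟨ε, ⟨⟨y₁, hy₁, r₁, hr₁, e₁⟩, ⟨y₂, hy₂, r₂, hr₂, e₂⟩⟩, hε⟩ :=
    (((eventually_smul_mem_polar hcl hne hm 0).and
      (eventually_smul_mem_polar hcl hne hm w)).and self_mem_nhdsWithin).exists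
  by_cases h1 : y₁ = k
  · refine ⟨y₂, hy₂, fun h2 => hw0 ?_⟩
    rw [h1, smul_zero, add_zero] at e₁
    rw [h2, e₁] at e₂
    have h3 := congrArg (fun z => inner ℝ w z) e₂
    have hw' : inner ℝ w (k : E3) = 0 := by rw [real_inner_comm]; exact hw
    simp only [inner_add_right, inner_smul_right, hw', mul_zero, zero_add] at h3
    have hε' : (0 : ℝ) < ε := hε
    exact inner_self_eq_zero.mp ((mul_eq_zero.mp h3).resolve_left hε'.ne')
  · exact ⟨y₁, hy₁, h1⟩

/-- A point of the polar farthest from `k` is the center of a supporting hemisphere forming a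
lune with the hemisphere of `k`. -/
theorem supports_of_farthest {C : Set S2} (hcl : IsClosed C) (hint : (interior C).Nonempty)
    {m : E3} (hm : ∀ x ∈ C, 0 < inner ℝ m (x : E3)) {k h : S2} (hk : k ∈ polar C)
    (hh : h ∈ polar C)
    (hmin : ∀ y ∈ polar C, inner ℝ (k : E3) (h : E3) ≤ inner ℝ (k : E3) (y : E3)) :
    Supports h C ∧ IsLunePair k h := by
  have hne : C.Nonempty := hint.mono interior_subset
  obtain ⟨y, hy, hyk⟩ := exists_mem_polar_ne hcl hne hm k
  set c := inner ℝ (k : E3) (h : E3) with hc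
  have hc1 : c < 1 := (hmin y hy).trans_lt (inner_lt_one (Ne.symm hyk))
  have hkh : k ≠ -h := ne_neg_of_mem_polar hint hk hh
  have hc2 : -1 < c := neg_one_lt_inner hkh
  refine ⟨?_, ?_, hkh⟩
  · by_contra hns
    have hpos : ∀ x ∈ C, 0 < inner ℝ (h : E3) (x : E3) := fun x hx =>
      lt_of_le_of_ne (hh x hx) fun h0 => hns (supports_of_mem_polar hh hx h0.symm)
    -- Since `h` is strictly positive on `C`, every direction is admissible. The direction `c • h -
    -- k`, leading away from `k`, yields `0 ≤ c ^ 2 - 1`.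
    have := inner_ge_of_minimizer hc.symm hmin
      (eventually_smul_mem_polar hcl hne hpos (c • (h : E3) - (k : E3)))
    have hc' : inner ℝ (h : E3) (k : E3) = c := by rw [hc, real_inner_comm]
    simp only [inner_sub_right, inner_smul_right, inner_self_sphere, hc', ← hc] at this
    nlinarith
  · rintro rfl
    rw [inner_self_sphere] at hc
    linarith

/-! ### Farthest pairs of the polar and the thickness of a body. -/

/-- A pair of points of the polar at maximal distance. -/
def IsFarthestPair (C : Set S2) (g h : S2) : Prop :=
  g ∈ polar C ∧ h ∈ polar C ∧
    ∀ a ∈ polar C, ∀ b ∈ polar C, inner ℝ (g : E3) (h : E3) ≤ inner ℝ (a : E3) (b : E3)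

theorem IsFarthestPair.symm {C : Set S2} {g h : S2} (H : IsFarthestPair C g h) :
    IsFarthestPair C h g :=
  ⟨H.2.1, H.1, fun a ha b hb => by rw [real_inner_comm]; exact H.2.2 a ha b hb⟩

theorem exists_isFarthestPair {C : Set S2} (hcl : IsClosed C) (hne : C.Nonempty)
    {m : E3} (hm : ∀ x ∈ C, 0 < inner ℝ m (x : E3)) : ∃ g h, IsFarthestPair C g h := by
  obtain ⟨x, hx⟩ := hne
  obtain ⟨y, hy, -⟩ := exists_mem_polar_ne hcl ⟨x, hx⟩ hm x
  have hp := (isClosed_polar C).isCompact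
  obtain ⟨⟨g, h⟩, hgh, hmin⟩ := (hp.prod hp).exists_isMinOn ⟨(y, y), hy, hy⟩
    (f := fun p : S2 × S2 => inner ℝ (p.1 : E3) (p.2 : E3)) (by fun_prop)
  exact ⟨g, h, hgh.1, hgh.2, fun a ha b hb => hmin (show (a, b) ∈ _ from ⟨ha, hb⟩)⟩

theorem IsFarthestPair.isLunePair {C : Set S2} {g h : S2} (H : IsFarthestPair C g h)
    (hcl : IsClosed C) (hint : (interior C).Nonempty)
    {m : E3} (hm : ∀ x ∈ C, 0 < inner ℝ m (x : E3)) : IsLunePair g h :=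
  (supports_of_farthest hcl hint hm H.1 H.2.1 fun y hy => H.2.2 g H.1 y hy).2

/-- The thickness is determined by a farthest pair of the polar. -/
theorem IsFarthestPair.thickness_eq {C : Set S2} {g h : S2} (H : IsFarthestPair C g h)
    (hcl : IsClosed C) (hint : (interior C).Nonempty)
    {m : E3} (hm : ∀ x ∈ C, 0 < inner ℝ m (x : E3)) :
    thickness C = Real.pi - Real.arccos (inner ℝ (g : E3) (h : E3)) := by
  have hlune := H.isLunePair hcl hint hm
  have hge : ∀ {a b : S2}, a ∈ polar C → b ∈ polar C → IsLunePair a b →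
      Real.pi - Real.arccos (inner ℝ (g : E3) (h : E3)) ≤ luneThickness a b := by
    intro a b ha hb hab
    rw [luneThickness_eq hab]
    exact sub_le_sub_left (Real.arccos_le_arccos (H.2.2 a ha b hb)) _
  have hwge : ∀ {a : S2}, Supports a C →
      Real.pi - Real.arccos (inner ℝ (g : E3) (h : E3)) ≤ width C a := by
    intro a ha
    have hp := (isClosed_polar C).isCompact
    obtain ⟨b, hb, hmin⟩ := hp.exists_isMinOn ⟨a, ha.mem_polar⟩
      (f := fun b : S2 => inner ℝ (a : E3) (b : E3)) (by fun_prop)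
    obtain ⟨hs, hl⟩ := supports_of_farthest hcl hint hm ha.mem_polar hb fun y hy => hmin hy
    refine le_csInf ⟨_, b, hs, hl, rfl⟩ ?_
    rintro _ ⟨b, hb, hab, rfl⟩
    exact hge ha.mem_polar hb.mem_polar hab
  have hsh : Supports h C :=
    (supports_of_farthest hcl hint hm H.1 H.2.1 fun y hy => H.2.2 g H.1 y hy).1
  have hsg : Supports g C :=
    (supports_of_farthest hcl hint hm H.2.1 H.1 fun y hy => H.symm.2.2 h H.2.1 y hy).1
  apply le_antisymm
  · calc thickness C ≤ width C g := by
          refine csInf_le ⟨Real.pi - Real.arccos (inner ℝ (g : E3) (h : E3)), ?_⟩ ⟨g, hsg, rfl⟩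
          rintro _ ⟨a, ha, rfl⟩
          exact hwge ha
      _ ≤ luneThickness g h := by
          refine csInf_le ⟨Real.pi - Real.arccos (inner ℝ (g : E3) (h : E3)), ?_⟩
            ⟨h, hsh, hlune, rfl⟩
          rintro _ ⟨b, hb, hab, rfl⟩
          exact hge H.1 hb.mem_polar hab
      _ = _ := luneThickness_eq hlune
  · refine le_csInf ⟨_, g, hsg, rfl⟩ ?_
    rintro _ ⟨a, ha, rfl⟩
    exact hwge ha

/-- The centers of the semicircles bounding a thinnest lune belong to the body. -/
theorem IsFarthestPair.exists_center {C : Set S2} {g h : S2} (H : IsFarthestPair C g h)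
    (hC : IsConvexBody C) :
    ∃ v ∈ C, (h : E3) - inner ℝ (g : E3) (h : E3) • (g : E3) =
      √(1 - inner ℝ (g : E3) (h : E3) ^ 2) • (v : E3) := by
  have hne : C.Nonempty := hC.2.2.mono interior_subset
  set c := inner ℝ (g : E3) (h : E3) with hc
  have hc' : inner ℝ (h : E3) (g : E3) = c := by rw [hc, real_inner_comm]
  -- The polar spans a convex cone, so every polar point `k` is an admissible direction at `g`.
  have key : ∀ k ∈ polar C, 0 ≤ inner ℝ (k : E3) ((h : E3) - c • (g : E3)) := by
    intro k hk
    have := inner_ge_of_minimizer (P := polar C) (w := (k : E3)) hc'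
      (fun y hy => H.2.2 y hy h H.2.1 |>.trans_eq (real_inner_comm _ _)) ?_
    · rw [inner_sub_right, inner_smul_right, real_inner_comm, real_inner_comm (g : E3) (k : E3)]
      linarith
    · filter_upwards [self_mem_nhdsWithin] with ε hε
      replace hε : (0 : ℝ) < ε := hε
      have h0 : (g : E3) + ε • (k : E3) ≠ 0 := by
        intro h0
        obtain ⟨x, hx⟩ := hC.2.2
        have h1 := inner_pos_of_mem_interior H.1 hx
        have h2 := inner_pos_of_mem_interior hk hx
        have h3 := congrArg (fun z => inner ℝ z (x : E3)) h0
        simp only [inner_add_left, inner_smul_left, conj_trivial, inner_zero_left] at h3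
        nlinarith
      obtain ⟨y, hy⟩ := exists_sphere_smul h0
      have hn : 0 < ‖(g : E3) + ε • (k : E3)‖ := norm_pos_iff.mpr h0
      refine ⟨y, fun x hx => ?_, _, hn, hy⟩
      have h1 : 0 ≤ inner ℝ ((g : E3) + ε • (k : E3)) (x : E3) := by
        rw [inner_add_left, inner_smul_left, conj_trivial]
        exact add_nonneg (H.1 x hx) (mul_nonneg hε.le (hk x hx))
      rw [hy, inner_smul_left, conj_trivial] at h1
      exact nonneg_of_mul_nonneg_right h1 hn
  obtain ⟨v, hv, e⟩ := exists_smul_of_inner_polar_nonneg hC.1 hC.2.1 hne key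
  refine ⟨v, hv, ?_⟩
  have hn : ‖(h : E3) - c • (g : E3)‖ = √(1 - c ^ 2) := by
    rw [← Real.sqrt_sq (norm_nonneg _), ← real_inner_self_eq_norm_sq]
    congr 1
    simp only [inner_sub_left, inner_sub_right, inner_smul_left, inner_smul_right,
      inner_self_sphere, hc', ← hc, conj_trivial]
    ring
  rw [← hn]; exact e

/-! ### Exposed points of reduced bodies. -/

/-- A point exposed in a convex body is not an interior point. -/
theorem notMem_interior_of_exposed {V : Set S2} {k : E3} {v : S2}
    (hkv : inner ℝ k (v : E3) = 0) (hk : ∀ x ∈ V, x ≠ v → 0 < inner ℝ k (x : E3)) :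
    v ∉ interior V := by
  intro h
  -- Along `w` one moves on the great circle orthogonal to `k`, which meets `V` at most in `v`.
  obtain ⟨w, hw0, hwv, hwk⟩ := exists_orthogonal (v : E3) k
  have hc : Tendsto (fun ε : ℝ => (v : E3) + ε • w) (𝓝[>] 0) (𝓝 (v : E3)) := by
    have : Continuous fun ε : ℝ => (v : E3) + ε • w := by fun_prop
    have h2 := this.tendsto 0
    simp only [zero_smul, add_zero] at h2
    exact h2.mono_left nhdsWithin_le_nhds
  obtain ⟨ε, ⟨y, hy, r, hr, e⟩, hε⟩ :=
    ((hc.eventually (eventually_smul_mem h)).and self_mem_nhdsWithin).exists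
  replace hε : (0 : ℝ) < ε := hε
  have hyv : y ≠ v := by
    rintro rfl
    have e2 := congrArg (fun z => inner ℝ w z) e
    have hw' : inner ℝ w (y : E3) = 0 := by rw [real_inner_comm]; exact hwv
    simp only [inner_add_right, inner_smul_right, hw', mul_zero, zero_add] at e2
    exact hw0 (inner_self_eq_zero.mp ((mul_eq_zero.mp e2).resolve_left hε.ne'))
  have e2 := congrArg (fun z => inner ℝ k z) e
  simp only [inner_add_right, inner_smul_right, hkv, hwk, mul_zero, zero_add] at e2
  exact (mul_pos hr (hk y hy hyv)).ne e2

/-- Cutting off a cap at an exposed point of a reduced body yields a thinner lune, one of whose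
centers lies on the cut. -/
theorem IsReduced.exists_lune_of_cap {V : Set S2} (hred : IsReduced V) {m k : E3}
    (hm : ∀ x ∈ V, 0 < inner ℝ m (x : E3)) {v x₀ g₀ h₀ : S2} (hv : v ∈ V)
    (hx₀ : x₀ ∈ interior V) (hkv : inner ℝ k (v : E3) = 0) (hfar : IsFarthestPair V g₀ h₀)
    {δ : ℝ} (hδ : 0 < δ) (hδ₀ : 0 < inner ℝ (k - δ • m) (x₀ : E3)) :
    ∃ p : S2 × S2 × S2 × S2,
      (∀ x ∈ V, 0 ≤ inner ℝ (k - δ • m) (x : E3) →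
        0 ≤ inner ℝ (p.1 : E3) (x : E3) ∧ 0 ≤ inner ℝ (p.2.1 : E3) (x : E3)) ∧
      inner ℝ (p.1 : E3) (p.2.1 : E3) < inner ℝ (g₀ : E3) (h₀ : E3) ∧
      p.2.2.1 ∈ V ∧ p.2.2.2 ∈ V ∧
      (p.2.1 : E3) - inner ℝ (p.1 : E3) (p.2.1 : E3) • (p.1 : E3) =
        √(1 - inner ℝ (p.1 : E3) (p.2.1 : E3) ^ 2) • (p.2.2.1 : E3) ∧
      (p.1 : E3) - inner ℝ (p.1 : E3) (p.2.1 : E3) • (p.2.1 : E3) =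
        √(1 - inner ℝ (p.1 : E3) (p.2.1 : E3) ^ 2) • (p.2.2.2 : E3) ∧
      inner ℝ (k - δ • m) (p.2.2.1 : E3) = 0 ∧
      inner ℝ (p.1 : E3) (p.2.2.1 : E3) = 0 := by
  obtain ⟨hV, hmin⟩ := hred
  set a : E3 := k - δ • m with ha
  let K : Set S2 := {x | x ∈ V ∧ 0 ≤ inner ℝ a (x : E3)}
  have hKV : K ⊆ V := fun x hx => hx.1
  have hK : IsConvexBody K := by
    refine ⟨⟨fun x hx hx' => hV.1.1 x hx.1 hx'.1, ?_⟩, ?_, x₀, ?_⟩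
    · intro x hx y hy z hz
      refine ⟨hV.1.2 x hx.1 y hy.1 hz, ?_⟩
      obtain ⟨s, t, hs, ht, e⟩ := hz
      rw [e, inner_add_right, inner_smul_right, inner_smul_right]
      exact add_nonneg (mul_nonneg hs hx.2) (mul_nonneg ht hy.2)
    · have hc : IsClosed {x : S2 | 0 ≤ inner ℝ a (x : E3)} :=
        isClosed_le continuous_const (by fun_prop)
      exact hV.2.1.inter hc
    · have ho : IsOpen {x : S2 | 0 < inner ℝ a (x : E3)} :=
        isOpen_lt continuous_const (by fun_prop)
      exact mem_interior.mpr ⟨interior V ∩ {x : S2 | 0 < inner ℝ a (x : E3)},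
        fun x hx => ⟨interior_subset hx.1, le_of_lt hx.2⟩, isOpen_interior.inter ho, hx₀, hδ₀⟩
  have hvK : v ∉ K := by
    intro h
    have h1 := h.2
    rw [ha, inner_sub_left, inner_smul_left, hkv, conj_trivial] at h1
    have := mul_pos hδ (hm v hv)
    linarith
  have hmK : ∀ x ∈ K, 0 < inner ℝ m (x : E3) := fun x hx => hm x hx.1
  have hthin := hmin K hK ⟨hKV, fun h => hvK (h hv)⟩
  obtain ⟨g, h, H⟩ := exists_isFarthestPair hK.2.1 (hK.2.2.mono interior_subset) hmK
  rw [H.thickness_eq hK.2.1 hK.2.2 hmK, hfar.thickness_eq hV.2.1 hV.2.2 hm] at hthin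
  have hlt : inner ℝ (g : E3) (h : E3) < inner ℝ (g₀ : E3) (h₀ : E3) := by
    by_contra! hle
    have := Real.arccos_le_arccos hle
    linarith
  clear hthin
  -- The pair is farther apart than any pair in `polar V`, so one of its members lies outside.
  wlog hg : g ∉ polar V generalizing g h
  · exact this h g H.symm (by rw [real_inner_comm]; exact hlt) fun hh =>
      (hfar.2.2 g (not_not.mp hg) h hh).not_gt hlt
  obtain ⟨y, hy, ey⟩ := H.exists_center hK
  obtain ⟨y', hy', ey'⟩ := H.symm.exists_center hK
  rw [real_inner_comm] at ey'
  have hl := H.isLunePair hK.2.1 hK.2.2 hmK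
  have hgy : inner ℝ (g : E3) (y : E3) = 0 := by
    have h1 := inner_lt_one hl.1
    have h2 := neg_one_lt_inner hl.2
    have e2 := congrArg (fun z => inner ℝ (g : E3) z) ey
    simp only [inner_sub_right, inner_smul_right, inner_self_sphere, mul_one, sub_self] at e2
    have h3 : 0 < √(1 - inner ℝ (g : E3) (h : E3) ^ 2) := Real.sqrt_pos.mpr (by nlinarith)
    exact (mul_eq_zero.mp e2.symm).resolve_left h3.ne'
  refine ⟨(g, h, y, y'), fun x hx hax => ⟨H.1 x ⟨hx, hax⟩, H.2.1 x ⟨hx, hax⟩⟩, hlt, hy.1, hy'.1,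
    ey, ey', ?_, hgy⟩
  refine le_antisymm ?_ hy.2
  -- If `y` were strictly inside the cut, a short move from `y` towards a point of `V` outside the
  -- hemisphere of `g` would stay in `K` but leave that hemisphere.
  by_contra! hpos
  replace hpos : 0 < inner ℝ a (y : E3) := hpos
  obtain ⟨x, hx, hgx⟩ : ∃ x ∈ V, inner ℝ (g : E3) (x : E3) < 0 := by
    by_contra! hall
    exact hg hall
  have hlim : Tendsto (fun ε : ℝ => inner ℝ a (y : E3) + ε * inner ℝ a (x : E3)) (𝓝[>] 0)
      (𝓝 (inner ℝ a (y : E3))) := by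
    have : Continuous fun ε : ℝ => inner ℝ a (y : E3) + ε * inner ℝ a (x : E3) := by fun_prop
    have h2 := this.tendsto 0
    simp only [zero_mul, add_zero] at h2
    exact h2.mono_left nhdsWithin_le_nhds
  obtain ⟨ε, hε, hε0⟩ := ((hlim.eventually (lt_mem_nhds hpos)).and self_mem_nhdsWithin).exists
  replace hε0 : (0 : ℝ) < ε := hε0
  obtain ⟨z, hz, r, hr, e⟩ := hV.1.exists_smul hy.1 hx zero_le_one hε0.le (by linarith)
  rw [one_smul] at e
  have e1 := congrArg (fun u => inner ℝ a u) e
  have e2 := congrArg (fun u => inner ℝ (g : E3) u) e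
  simp only [inner_add_right, inner_smul_right, hgy] at e1 e2
  have haz : 0 ≤ inner ℝ a (z : E3) := by
    rw [e1] at hε
    exact (pos_of_mul_pos_right hε hr.le).le
  have := mul_nonneg hr.le (H.1 z ⟨hz, haz⟩)
  nlinarith

/-- Every exposed point of a reduced body is the center of one of the semicircles bounding a
thinnest lune. -/
theorem IsReduced.exists_lune {V : Set S2} (hred : IsReduced V) {m k : E3}
    (hm : ∀ x ∈ V, 0 < inner ℝ m (x : E3)) {v : S2} (hv : v ∈ V)
    (hkv : inner ℝ k (v : E3) = 0) (hk : ∀ x ∈ V, x ≠ v → 0 < inner ℝ k (x : E3)) :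
    ∃ g h t : S2, IsFarthestPair V g h ∧ t ∈ V ∧
      (h : E3) - inner ℝ (g : E3) (h : E3) • (g : E3) =
        √(1 - inner ℝ (g : E3) (h : E3) ^ 2) • (v : E3) ∧
      (g : E3) - inner ℝ (g : E3) (h : E3) • (h : E3) =
        √(1 - inner ℝ (g : E3) (h : E3) ^ 2) • (t : E3) := by
  obtain ⟨x₀, hx₀⟩ := hred.1.2.2
  obtain ⟨g₀, h₀, hfar⟩ := exists_isFarthestPair hred.1.2.1 ⟨v, hv⟩ hm
  have hkx₀ : 0 < inner ℝ k (x₀ : E3) := hk x₀ (interior_subset hx₀) fun h =>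
    notMem_interior_of_exposed hkv hk (h ▸ hx₀)
  have hδlim : Tendsto (fun n : ℕ => (1 : ℝ) / ((n : ℝ) + 1)) atTop (𝓝 0) :=
    tendsto_one_div_add_atTop_nhds_zero_nat
  have hposlim : ∀ {x : S2}, 0 < inner ℝ k (x : E3) →
      ∀ᶠ n : ℕ in atTop, 0 < inner ℝ (k - ((1 : ℝ) / ((n : ℝ) + 1)) • m) (x : E3) := by
    intro x hx
    have hcont : Continuous fun δ : ℝ => inner ℝ (k - δ • m) (x : E3) := by fun_prop
    have h2 := (hcont.tendsto 0).comp hδlim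
    simp only [zero_smul, sub_zero] at h2
    exact h2.eventually (lt_mem_nhds hx)
  -- Shifting the index by `N` keeps `x₀` strictly inside every cut.
  obtain ⟨N, hN⟩ := eventually_atTop.mp (hposlim hkx₀)
  have hex := fun n : ℕ => hred.exists_lune_of_cap hm hv hx₀ hkv hfar
    (δ := (1 : ℝ) / (((n + N : ℕ) : ℝ) + 1)) (by positivity) (hN (n + N) (by omega))
  choose p hp1 hp2 hp3 hp4 hp5 hp6 hp7 hp8 using hex
  obtain ⟨⟨g, h, y, t⟩, -, φ, hφ, hlim⟩ := isCompact_univ.tendsto_subseq (x := p)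
    fun n => Set.mem_univ _
  have hidx : Tendsto (fun n => φ n + N) atTop atTop :=
    tendsto_atTop_mono (fun n => Nat.le_add_right _ _) hφ.tendsto_atTop
  have hg : Tendsto (fun n => ((p (φ n)).1 : E3)) atTop (𝓝 (g : E3)) :=
    ((continuous_subtype_val.comp continuous_fst).tendsto (g, h, y, t)).comp hlim
  have hh : Tendsto (fun n => ((p (φ n)).2.1 : E3)) atTop (𝓝 (h : E3)) :=
    ((continuous_subtype_val.comp (continuous_fst.comp continuous_snd)).tendsto
      (g, h, y, t)).comp hlim
  have hyS : Tendsto (fun n => (p (φ n)).2.2.1) atTop (𝓝 y) :=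
    ((continuous_fst.comp (continuous_snd.comp continuous_snd)).tendsto (g, h, y, t)).comp hlim
  have htS : Tendsto (fun n => (p (φ n)).2.2.2) atTop (𝓝 t) :=
    ((continuous_snd.comp (continuous_snd.comp continuous_snd)).tendsto (g, h, y, t)).comp hlim
  have hy : Tendsto (fun n => ((p (φ n)).2.2.1 : E3)) atTop (𝓝 (y : E3)) :=
    (continuous_subtype_val.tendsto _).comp hyS
  have ht : Tendsto (fun n => ((p (φ n)).2.2.2 : E3)) atTop (𝓝 (t : E3)) :=
    (continuous_subtype_val.tendsto _).comp htS
  have hyV : y ∈ V := hred.1.2.1.mem_of_tendsto hyS (Eventually.of_forall fun n => hp3 _)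
  have htV : t ∈ V := hred.1.2.1.mem_of_tendsto htS (Eventually.of_forall fun n => hp4 _)
  -- The centers lie on the cuts, which tend to the great circle orthogonal to `k`; it meets `V`
  -- only in `v`.
  have hyv : y = v := by
    by_contra hne
    have h1 : Tendsto (fun n => inner ℝ (k - ((1 : ℝ) / (((φ n + N : ℕ) : ℝ) + 1)) • m)
        ((p (φ n)).2.2.1 : E3)) atTop (𝓝 (inner ℝ (k - (0 : ℝ) • m) (y : E3))) :=
      (tendsto_const_nhds.sub ((hδlim.comp hidx).smul tendsto_const_nhds)).inner hy
    simp only [hp7, zero_smul, sub_zero] at h1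
    exact (hk y hyV hne).ne (tendsto_nhds_unique tendsto_const_nhds h1)
  subst hyv
  have hgy : inner ℝ (g : E3) (y : E3) = 0 := by
    have h1 := hg.inner (𝕜 := ℝ) hy
    simp only [hp8] at h1
    exact (tendsto_nhds_unique tendsto_const_nhds h1).symm
  have hc : Tendsto (fun n => inner ℝ ((p (φ n)).1 : E3) ((p (φ n)).2.1 : E3)) atTop
      (𝓝 (inner ℝ (g : E3) (h : E3))) := hg.inner hh
  have hs := (Real.continuous_sqrt.tendsto _).comp
    ((tendsto_const_nhds (x := (1 : ℝ))).sub (hc.pow 2))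
  have e1 := tendsto_nhds_unique (hh.sub (hc.smul hg)) ((hs.smul hy).congr fun n => (hp5 _).symm)
  have e2 := tendsto_nhds_unique (hg.sub (hc.smul hh)) ((hs.smul ht).congr fun n => (hp6 _).symm)
  have hle : inner ℝ (g : E3) (h : E3) ≤ inner ℝ (g₀ : E3) (h₀ : E3) :=
    le_of_tendsto hc (Eventually.of_forall fun n => (hp2 _).le)
  have hev : ∀ x ∈ V, x ≠ y → ∀ᶠ n in atTop, 0 ≤ inner ℝ ((p (φ n)).1 : E3) (x : E3) ∧
      0 ≤ inner ℝ ((p (φ n)).2.1 : E3) (x : E3) := by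
    intro x hx hxy
    filter_upwards [hidx.eventually (hposlim (hk x hx hxy))] with n hn
    exact hp1 _ x hx hn.le
  have hgV : g ∈ polar V := by
    intro x hx
    by_cases hxy : x = y
    · rw [hxy, hgy]
    · exact ge_of_tendsto (hg.inner tendsto_const_nhds) ((hev x hx hxy).mono fun n hn => hn.1)
  have hhV : h ∈ polar V := by
    intro x hx
    by_cases hxy : x = y
    -- The vertex itself is always cut off, so its sign is obtained from the centers converging to
    -- it.
    · rw [hxy]
      exact ge_of_tendsto (hh.inner hy) (Eventually.of_forall fun n =>
        (hp1 _ _ (hp3 _) (hp7 _).ge).2)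
    · exact ge_of_tendsto (hh.inner tendsto_const_nhds) ((hev x hx hxy).mono fun n hn => hn.2)
  exact ⟨g, h, t, ⟨hgV, hhV, fun a ha b hb => hle.trans (hfar.2.2 a ha b hb)⟩, htV, e1, e2⟩

/-! ### Two arcs of thinnest lunes are not separated. -/

/-- Excludes crossing diagonals: the equations are the inner products of `a v + c u = b t + d y`
with `v`, `t`, `u`, `y`. Elimination gives `b ≤ c * r`, `c ≤ b * r`, `a ≤ d * q` and `d ≤ a * q`,
where `q, r < 1`. -/
theorem eq_zero_of_diagonal_relation {a b c d κ p q r w : ℝ} (hκ : 0 ≤ κ) (hκ1 : κ < 1)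
    (ha : 0 ≤ a) (hb : 0 ≤ b) (hc : 0 ≤ c) (hd : 0 ≤ d) (hq : q < 1) (hr : r < 1)
    (h1 : κ * q ≤ w) (h2 : κ * r ≤ p) (h3 : κ * r ≤ w) (h4 : κ * q ≤ p)
    (e1 : a + c * p = b * κ + d * q) (e2 : a * κ + c * r = b + d * w)
    (e3 : a * p + c = b * r + d * κ) (e4 : a * q + c * κ = b * w + d) :
    a = 0 ∧ b = 0 ∧ c = 0 ∧ d = 0 := by
  have hS : 0 < 1 - κ ^ 2 := by nlinarith
  have f1 : c * (r - κ * p) = b * (1 - κ ^ 2) + d * (w - κ * q) := by linear_combination e2 - κ * e1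
  have f2 : a * (1 - κ ^ 2) + c * (p - κ * r) = d * (q - κ * w) := by linear_combination e1 - κ * e2
  have f3 : a * (q - κ * p) = b * (w - κ * r) + d * (1 - κ ^ 2) := by linear_combination e4 - κ * e3
  have f4 : a * (p - κ * q) + c * (1 - κ ^ 2) = b * (r - κ * w) := by linear_combination e3 - κ * e4
  have g1 : r - κ * p ≤ r * (1 - κ ^ 2) := by linarith [mul_le_mul_of_nonneg_left h2 hκ]
  have g2 : q - κ * w ≤ q * (1 - κ ^ 2) := by linarith [mul_le_mul_of_nonneg_left h1 hκ]
  have g3 : q - κ * p ≤ q * (1 - κ ^ 2) := by linarith [mul_le_mul_of_nonneg_left h4 hκ]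
  have g4 : r - κ * w ≤ r * (1 - κ ^ 2) := by linarith [mul_le_mul_of_nonneg_left h3 hκ]
  have k1 : b ≤ c * r := by
    refine le_of_mul_le_mul_right ?_ hS
    linarith [mul_le_mul_of_nonneg_left g1 hc, mul_nonneg hd (sub_nonneg.mpr h1)]
  have k2 : a ≤ d * q := by
    refine le_of_mul_le_mul_right ?_ hS
    linarith [mul_le_mul_of_nonneg_left g2 hd, mul_nonneg hc (sub_nonneg.mpr h2)]
  have k3 : d ≤ a * q := by
    refine le_of_mul_le_mul_right ?_ hS
    linarith [mul_le_mul_of_nonneg_left g3 ha, mul_nonneg hb (sub_nonneg.mpr h3)]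
  have k4 : c ≤ b * r := by
    refine le_of_mul_le_mul_right ?_ hS
    linarith [mul_le_mul_of_nonneg_left g4 hb, mul_nonneg ha (sub_nonneg.mpr h4)]
  have aux : ∀ {x z s : ℝ}, 0 ≤ x → 0 ≤ z → s < 1 → x ≤ z * s → z ≤ x * s → x = 0 ∧ z = 0 := by
    intro x z s hx hz hs h1 h2
    have hzx : z ≤ x := h2.trans (mul_le_of_le_one_right hx hs.le)
    have hz0 : z = 0 := by
      by_contra hne
      have hzp : 0 < z := lt_of_le_of_ne hz (Ne.symm hne)
      linarith [mul_lt_of_lt_one_right hzp hs]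
    subst hz0
    exact ⟨by linarith, rfl⟩
  obtain ⟨hb0, hc0⟩ := aux hb hc hr k1 k4
  obtain ⟨ha0, hd0⟩ := aux ha hd hq k2 k3
  exact ⟨ha0, hb0, hc0, hd0⟩

/-- Treats a relation `c u = a v + b t + d y`, one endpoint against the other three. The vector `y -
κ u` is orthogonal to `u`, has nonnegative products `i`, `j` with `v`, `t`, and product `1 - κ ^ 2 >
0` with `y`. -/
theorem eq_zero_of_triangle_relation {a b d c κ i j p q r w : ℝ} (hκ1 : 0 < 1 - κ ^ 2)
    (ha : 0 ≤ a) (hb : 0 ≤ b) (hd : 0 ≤ d) (hi : 0 ≤ i) (hj : 0 ≤ j)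
    (hpi : i = q - κ * p) (hrj : j = w - κ * r)
    (e3 : a * p + b * r + d * κ = c) (e4 : a * q + b * w + d = c * κ) : d = 0 := by
  have : a * i + b * j + d * (1 - κ ^ 2) = 0 := by
    rw [hpi, hrj]; linear_combination e4 - κ * e3
  have h1 := mul_nonneg ha hi
  have h2 := mul_nonneg hb hj
  have h3 : d * (1 - κ ^ 2) ≤ 0 := by linarith
  nlinarith

/-- Two arcs of the same length `≤ π / 2`, each of which lies in the lune orthogonal to the other
one at its endpoints, are not separated by a great circle. -/
theorem not_separated {v t u y m l : E3} {κ : ℝ} (hκ : 0 ≤ κ) (hκ1 : κ < 1)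
    (hv : inner ℝ v v = 1) (ht : inner ℝ t t = 1) (hu : inner ℝ u u = 1) (hy : inner ℝ y y = 1)
    (hvt : inner ℝ v t = κ) (huy : inner ℝ u y = κ)
    (hmv : 0 < inner ℝ m v) (hmt : 0 < inner ℝ m t) (hmu : 0 < inner ℝ m u)
    (hmy : 0 < inner ℝ m y)
    (h1 : κ * inner ℝ v u ≤ inner ℝ t u) (h2 : κ * inner ℝ v y ≤ inner ℝ t y)
    (h3 : κ * inner ℝ t u ≤ inner ℝ v u) (h4 : κ * inner ℝ t y ≤ inner ℝ v y)
    (h5 : κ * inner ℝ v u ≤ inner ℝ v y) (h6 : κ * inner ℝ t u ≤ inner ℝ t y)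
    (h7 : κ * inner ℝ v y ≤ inner ℝ v u) (h8 : κ * inner ℝ t y ≤ inner ℝ t u)
    (hlv : 0 < inner ℝ l v) (hlt : 0 < inner ℝ l t) (hlu : inner ℝ l u ≤ 0)
    (hly : inner ℝ l y ≤ 0) : False := by
  have hS : 0 < 1 - κ ^ 2 := by nlinarith
  have hlt1 : ∀ {x z : E3}, inner ℝ x x = 1 → inner ℝ z z = 1 → 0 < inner ℝ l x →
      inner ℝ l z ≤ 0 → inner ℝ x z < 1 := by
    intro x z hx hz hlx hlz
    rw [inner_lt_one_iff_real_of_norm_eq_one]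
    · rintro rfl; linarith
    · rw [norm_eq_sqrt_real_inner, hx, Real.sqrt_one]
    · rw [norm_eq_sqrt_real_inner, hz, Real.sqrt_one]
  have hp1 := hlt1 hv hu hlv hlu
  have hq1 := hlt1 hv hy hlv hly
  have hr1 := hlt1 ht hu hlt hlu
  have hw1 := hlt1 ht hy hlt hly
  have hdep : ¬ LinearIndependent ℝ ![v, t, u, y] := by
    intro h
    have := h.fintype_card_le_finrank
    simp at this
  obtain ⟨f, hf, hne⟩ := Fintype.not_linearIndependent_iff.mp hdep
  simp only [Fin.sum_univ_four, Matrix.cons_val] at hf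
  have key : ∀ a b c d : ℝ, 0 ≤ a → a • v + b • t + c • u + d • y = 0 →
      a = 0 ∧ b = 0 ∧ c = 0 ∧ d = 0 := by
    intro a b c d ha e
    have ev := congrArg (fun z => inner ℝ v z) e
    have et := congrArg (fun z => inner ℝ t z) e
    have eu := congrArg (fun z => inner ℝ u z) e
    have ey := congrArg (fun z => inner ℝ y z) e
    have el := congrArg (fun z => inner ℝ l z) e
    have em := congrArg (fun z => inner ℝ m z) e
    simp only [inner_add_right, inner_smul_right, inner_zero_right, hv, ht, hu, hy, hvt, huy,
      real_inner_comm v t, real_inner_comm v u, real_inner_comm v y, real_inner_comm t u,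
      real_inner_comm t y, real_inner_comm u y] at ev et eu ey el em
    generalize inner ℝ v u = p at *
    generalize inner ℝ v y = q at *
    generalize inner ℝ t u = r at *
    generalize inner ℝ t y = w at *
    generalize inner ℝ l v = l1 at *
    generalize inner ℝ l t = l2 at *
    generalize inner ℝ l u = l3 at *
    generalize inner ℝ l y = l4 at *
    generalize inner ℝ m v = m1 at *
    generalize inner ℝ m t = m2 at *
    generalize inner ℝ m u = m3 at *
    generalize inner ℝ m y = m4 at *
    clear hf hne hdep hlt1
    have zero : ∀ {x z : ℝ}, 0 ≤ x → 0 < z → x * z ≤ 0 → x = 0 := fun hx hz h => by nlinarith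
    have cross : 0 ≤ b → c ≤ 0 → d ≤ 0 → a = 0 ∧ b = 0 ∧ c = 0 ∧ d = 0 := by
      intro hb hc hd
      have s1 := mul_nonneg ha hlv.le
      have s2 := mul_nonneg hb hlt.le
      have s3 := mul_nonneg_of_nonpos_of_nonpos hc hlu
      have s4 := mul_nonneg_of_nonpos_of_nonpos hd hly
      have ha0 := zero ha hlv (by linarith)
      have hb0 := zero hb hlt (by linarith)
      subst ha0 hb0
      have s5 := mul_nonneg (neg_nonneg.mpr hc) hmu.le
      have s6 := mul_nonneg (neg_nonneg.mpr hd) hmy.le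
      exact ⟨rfl, rfl, by linarith [zero (neg_nonneg.mpr hc) hmu (by linarith)],
        by linarith [zero (neg_nonneg.mpr hd) hmy (by linarith)]⟩
    have cross' : b ≤ 0 → 0 ≤ c → 0 ≤ d → a = 0 → a = 0 ∧ b = 0 ∧ c = 0 ∧ d = 0 := by
      intro hb hc hd ha0
      subst ha0
      have s2 := mul_nonneg (neg_nonneg.mpr hb) hlt.le
      have s3 := mul_nonneg hc (neg_nonneg.mpr hlu)
      have s4 := mul_nonneg hd (neg_nonneg.mpr hly)
      have hb0 := zero (neg_nonneg.mpr hb) hlt (by linarith)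
      have hb0' : b = 0 := by linarith
      subst hb0'
      have s5 := mul_nonneg hc hmu.le
      have s6 := mul_nonneg hd hmy.le
      exact ⟨rfl, rfl, zero hc hmu (by linarith), zero hd hmy (by linarith)⟩
    -- By sign pattern: equal signs are excluded by `m`, arc against arc by `l`, and crossing
    -- diagonals by the diagonal relation. With one endpoint against three, the coefficient of its
    -- partner on the same arc vanishes, and the rest is again arc against arc.
    rcases le_total 0 b with hb | hb <;> rcases le_total 0 c with hc | hc <;>
      rcases le_total 0 d with hd | hd
    · have s1 := mul_nonneg ha hmv.le
      have s2 := mul_nonneg hb hmt.le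
      have s3 := mul_nonneg hc hmu.le
      have s4 := mul_nonneg hd hmy.le
      exact ⟨zero ha hmv (by linarith), zero hb hmt (by linarith), zero hc hmu (by linarith),
        zero hd hmy (by linarith)⟩
    · have hc0 : c = 0 := eq_zero_of_triangle_relation (c := -d) hS ha hb hc
        (sub_nonneg.mpr h7) (sub_nonneg.mpr h8) rfl rfl (by linarith) (by linarith)
      exact cross hb hc0.le hd
    · have hd0 : d = 0 := eq_zero_of_triangle_relation (c := -c) hS ha hb hd
        (sub_nonneg.mpr h5) (sub_nonneg.mpr h6) rfl rfl (by linarith) (by linarith)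
      exact cross hb hc hd0.le
    · exact cross hb hc hd
    · have ha0 : a = 0 := eq_zero_of_triangle_relation (c := -b) hS hc hd ha
        (sub_nonneg.mpr h3) (sub_nonneg.mpr h4) rfl rfl (by linarith) (by linarith)
      exact cross' hb hc hd ha0
    · obtain ⟨k1, k2, k3, k4⟩ := eq_zero_of_diagonal_relation (b := -b) (d := -d) hκ hκ1 ha
        (by linarith) hc (by linarith) hq1 hr1 h2 h3 h6 h7
        (by linarith) (by linarith) (by linarith) (by linarith)
      exact ⟨k1, by linarith, k3, by linarith⟩
    · obtain ⟨k1, k2, k3, k4⟩ := eq_zero_of_diagonal_relation (b := -b) (d := -c) (c := d) hκ hκ1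
        ha (by linarith) hd (by linarith) hp1 hw1 h1 h4 h8 h5
        (by linarith) (by linarith) (by linarith) (by linarith)
      exact ⟨k1, by linarith, by linarith, k3⟩
    · have hb0 : -b = 0 := eq_zero_of_triangle_relation (c := a) hS (neg_nonneg.mpr hc)
        (neg_nonneg.mpr hd) (neg_nonneg.mpr hb)
        (sub_nonneg.mpr h1) (sub_nonneg.mpr h2) rfl rfl (by linarith) (by linarith)
      exact cross (by linarith) hc hd
  have hzero : f 0 = 0 ∧ f 1 = 0 ∧ f 2 = 0 ∧ f 3 = 0 := by
    rcases le_total 0 (f 0) with h0 | h0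
    · exact key _ _ _ _ h0 hf
    · have hf' : (-f 0) • v + (-f 1) • t + (-f 2) • u + (-f 3) • y = 0 := by
        rw [← neg_eq_zero, ← hf]; module
      simpa using key _ _ _ _ (neg_nonneg.mpr h0) hf'
  obtain ⟨i, hi⟩ := hne
  fin_cases i
  · exact hi hzero.1
  · exact hi hzero.2.1
  · exact hi hzero.2.2.1
  · exact hi hzero.2.2.2

/-! ### The measure of the great circles separating two points. -/

/-- The normals in the unit ball of the planes separating `a` from `b`. -/
def separating (a b : E3) : Set E3 :=
  {u | u ∈ Metric.ball (0 : E3) 1 ∧ ¬ (0 < inner ℝ u a ↔ 0 < inner ℝ u b)}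

theorem measurableSet_separating (a b : E3) : MeasurableSet (separating a b) := by
  have h : ∀ c : E3, MeasurableSet {u : E3 | 0 < inner ℝ u c} := fun c =>
    (isOpen_lt continuous_const (by fun_prop)).measurableSet
  exact Metric.isOpen_ball.measurableSet.inter (((h a).iff (h b)).compl)

theorem volume_separating_lt_top (a b : E3) : volume (separating a b) < ⊤ :=
  (measure_mono fun _ hu => hu.1).trans_lt (measure_ball_lt_top (x := (0 : E3)) (r := 1))

/-- Two reflections suffice: the first takes `a` to `c`; the second corrects the image of `b` and
fixes `c`, which is orthogonal to `L₁ b - e`. -/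
theorem exists_isometry {a b c e : E3} (ha : ‖a‖ = 1) (hb : ‖b‖ = 1) (hc : ‖c‖ = 1)
    (he : ‖e‖ = 1) (h : inner ℝ a b = inner ℝ c e) : ∃ L : E3 ≃ₗᵢ[ℝ] E3, L a = c ∧ L b = e := by
  let L₁ : E3 ≃ₗᵢ[ℝ] E3 := (ℝ ∙ (a - c))ᗮ.reflection
  have h1 : L₁ a = c := Submodule.reflection_sub (ha.trans hc.symm)
  let L₂ : E3 ≃ₗᵢ[ℝ] E3 := (ℝ ∙ (L₁ b - e))ᗮ.reflection
  have h2 : L₂ (L₁ b) = e := Submodule.reflection_sub (by rw [L₁.norm_map, hb, he])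
  have h3 : L₂ c = c := by
    apply Submodule.reflection_mem_subspace_eq_self
    rw [Submodule.mem_orthogonal_singleton_iff_inner_left, inner_sub_right, ← h, ← h1,
      L₁.inner_map_map, sub_self]
  exact ⟨L₁.trans L₂, by simp [h1, h3], by simp [h2]⟩

theorem volume_separating_eq {a b c e : E3} (ha : ‖a‖ = 1) (hb : ‖b‖ = 1) (hc : ‖c‖ = 1)
    (he : ‖e‖ = 1) (h : inner ℝ a b = inner ℝ c e) :
    volume (separating a b) = volume (separating c e) := by
  obtain ⟨L, rfl, rfl⟩ := exists_isometry ha hb hc he h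
  rw [← L.measurePreserving.measure_preimage
    (measurableSet_separating (L a) (L b)).nullMeasurableSet]
  congr 1
  ext u
  simp [separating, L.inner_map_map]

/-- The measure of the set of planes separating two points of the sphere increases with their
distance. -/
theorem volume_separating_lt {a b c d : E3} (ha : ‖a‖ = 1) (hb : ‖b‖ = 1) (hc : ‖c‖ = 1)
    (hd : ‖d‖ = 1) (h0 : 0 ≤ inner ℝ a b) (h1 : inner ℝ a b < 1) (hρ : -1 < inner ℝ c d)
    (h : inner ℝ c d < inner ℝ a b) : volume (separating a b) < volume (separating c d) := by
  set κ := inner ℝ a b with hκ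
  set ρ := inner ℝ c d with hρd
  set σ := √(1 - κ ^ 2) with hσ
  set τ := √(1 - ρ ^ 2) with hτ
  have hσ2 : σ ^ 2 = 1 - κ ^ 2 := Real.sq_sqrt (by nlinarith)
  have hτ2 : τ ^ 2 = 1 - ρ ^ 2 := Real.sq_sqrt (by nlinarith)
  have hσ0 : 0 < σ := Real.sqrt_pos.mpr (by nlinarith)
  have hτ0 : 0 < τ := Real.sqrt_pos.mpr (by nlinarith)
  -- This says that the sine of the difference of the two distances is positive.
  have hlt : ρ * σ < κ * τ := by
    rcases le_or_gt ρ 0 with hρ0 | hρ0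
    · rcases h0.eq_or_lt with hk | hk
      · rw [← hk] at h ⊢; nlinarith
      · nlinarith [mul_pos hk hτ0]
    · have : σ < τ := by
        apply Real.sqrt_lt_sqrt <;> nlinarith
      nlinarith
  have hcc : inner ℝ c c = 1 := by rw [real_inner_self_eq_norm_sq, hc, one_pow]
  have hdd : inner ℝ d d = 1 := by rw [real_inner_self_eq_norm_sq, hd, one_pow]
  set f : E3 := τ⁻¹ • (d - ρ • c) with hf
  have hdf : d = ρ • c + τ • f := by
    rw [hf, smul_smul, mul_inv_cancel₀ hτ0.ne', one_smul]; abel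
  have hcf : inner ℝ c f = 0 := by
    rw [hf, inner_smul_right, inner_sub_right, inner_smul_right, hcc, ← hρd]; ring
  have hff : inner ℝ f f = 1 := by
    have hdc : inner ℝ d c = ρ := by rw [hρd, real_inner_comm]
    rw [hf]
    simp only [inner_smul_left, inner_smul_right, inner_sub_left, inner_sub_right, hcc, hdd,
      hdc, ← hρd, conj_trivial]
    field_simp
    rw [hτ2]; ring
  have hfc : inner ℝ f c = 0 := by rw [real_inner_comm]; exact hcf
  -- The point on the arc from `c` to `d` whose distance from `c` equals that of `a` and `b`.
  set e : E3 := κ • c + σ • f with he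
  have hce : inner ℝ c e = κ := by
    rw [he, inner_add_right, inner_smul_right, inner_smul_right, hcc, hcf]; ring
  have hen : ‖e‖ = 1 := by
    rw [norm_eq_sqrt_real_inner, he]
    simp only [inner_add_left, inner_add_right, inner_smul_left, inner_smul_right, hcc, hcf, hff,
      hfc, conj_trivial]
    rw [show κ * (κ * 1 + σ * 0) + σ * (κ * 0 + σ * 1) = 1 by nlinarith, Real.sqrt_one]
  rw [volume_separating_eq ha hb hc hen (hce.trans rfl).symm]
  have hcomb : τ • e = (κ * τ - ρ * σ) • c + σ • d := by
    rw [he, hdf]; module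
  -- Normals of planes separating `d` from both `c` and `e`: an open set that makes the inequality
  -- strict.
  let W : Set E3 := Metric.ball (0 : E3) 1 ∩
    ({u | 0 < inner ℝ u c} ∩ ({u | 0 < inner ℝ u e} ∩ {u | inner ℝ u d < 0}))
  have hWo : IsOpen W := Metric.isOpen_ball.inter
    ((isOpen_lt continuous_const (by fun_prop)).inter
      ((isOpen_lt continuous_const (by fun_prop)).inter
        (isOpen_lt (by fun_prop) continuous_const)))
  have hWne : W.Nonempty := by
    obtain ⟨z, hz1, hz2⟩ : ∃ z : ℝ, 0 < κ + σ * z ∧ ρ + τ * z < 0 := by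
      have hlt' : -(κ / σ) < -(ρ / τ) := by
        rw [neg_lt_neg_iff, div_lt_div_iff₀ hτ0 hσ0]; exact hlt
      obtain ⟨z, hz1, hz2⟩ := exists_between hlt'
      refine ⟨z, ?_, ?_⟩
      · rw [← neg_div, div_lt_iff₀ hσ0] at hz1; linarith
      · rw [← neg_div, lt_div_iff₀ hτ0] at hz2; linarith
    set u : E3 := c + z • f with hu
    have u1 : inner ℝ u c = 1 := by
      rw [hu, inner_add_left, inner_smul_left, hcc, hfc]; simp
    have u2 : inner ℝ u e = κ + σ * z := by
      rw [hu, he]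
      simp only [inner_add_left, inner_add_right, inner_smul_left, inner_smul_right, hcc, hcf, hff,
        hfc, conj_trivial]
      ring
    have u3 : inner ℝ u d = ρ + τ * z := by
      rw [hu, hdf]
      simp only [inner_add_left, inner_add_right, inner_smul_left, inner_smul_right, hcc, hcf, hff,
        hfc, conj_trivial]
      ring
    have hn : 0 < (‖u‖ + 1)⁻¹ := by positivity
    refine ⟨(‖u‖ + 1)⁻¹ • u, ?_, ?_, ?_, ?_⟩
    · rw [mem_ball_zero_iff, norm_smul, norm_inv, Real.norm_of_nonneg (by positivity),
        inv_mul_lt_one₀ (by positivity)]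
      linarith
    · simp only [Set.mem_ofPred_eq, inner_smul_left, conj_trivial, u1]; positivity
    · simp only [Set.mem_ofPred_eq, inner_smul_left, conj_trivial, u2]; positivity
    · simp only [Set.mem_ofPred_eq, inner_smul_left, conj_trivial, u3]
      exact mul_neg_of_pos_of_neg hn hz2
  have hWpos : 0 < volume W := hWo.measure_pos volume hWne
  have hdisj : Disjoint (separating c e) W := by
    rw [Set.disjoint_left]
    rintro u hu ⟨-, hu1, hu2, -⟩
    exact hu.2 ⟨fun _ => hu2, fun _ => hu1⟩
  -- As `e` is a positive combination of `c` and `d`, a plane separating `c` from `e` separates `c`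
  -- from `d`.
  have hsub : separating c e ∪ W ⊆ separating c d := by
    rintro u (hu | ⟨hu0, hu1, -, hu3⟩)
    · refine ⟨hu.1, fun hcd => hu.2 ?_⟩
      have e1 := congrArg (fun x => inner ℝ u x) hcomb
      simp only [inner_add_right, inner_smul_right] at e1
      have hk : 0 < κ * τ - ρ * σ := by linarith
      constructor
      · intro h2
        have h3 := hcd.1 h2
        have : 0 < τ * inner ℝ u e := by rw [e1]; positivity
        exact pos_of_mul_pos_right this hτ0.le
      · intro h2
        by_contra h3
        have h4 : ¬ 0 < inner ℝ u d := fun h => h3 (hcd.2 h)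
        push Not at h3 h4
        nlinarith [mul_pos hτ0 h2, mul_nonneg hk.le (neg_nonneg.mpr h3),
          mul_nonneg hσ0.le (neg_nonneg.mpr h4)]
    · exact ⟨hu0, fun hcd => (hcd.1 hu1).not_gt hu3⟩
  calc volume (separating c e) < volume (separating c e) + volume W :=
        ENNReal.lt_add_right (volume_separating_lt_top c e).ne hWpos.ne'
    _ = volume (separating c e ∪ W) := (measure_union hdisj hWo.measurableSet).symm
    _ ≤ volume (separating c d) := measure_mono hsub

/-! ### Rematching the endpoints of the arcs. -/

open Classical in
/-- If no index satisfies both `P` and `Q`, then the number of indices satisfying exactly one of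
them does not grow under a permutation of the indices of `Q`. -/
theorem sum_not_iff_comp_le {ι : Type*} {S : Finset ι} {f : ι → ι} (hf : Set.BijOn f S S)
    {P Q : ι → Prop} (h : ∀ i ∈ S, ¬ (P i ∧ Q i)) :
    ∑ i ∈ S, (if ¬ (P i ↔ Q (f i)) then (1 : ℝ≥0∞) else 0) ≤
      ∑ i ∈ S, (if ¬ (P i ↔ Q i) then (1 : ℝ≥0∞) else 0) := by
  -- The count of "exactly one" is at most the sum of both counts, which `f` preserves; for the
  -- original matching, equality holds by exclusivity.
  have h1 : ∀ i, (if ¬ (P i ↔ Q (f i)) then (1 : ℝ≥0∞) else 0) ≤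
      (if P i then 1 else 0) + (if Q (f i) then 1 else 0) := by
    intro i
    by_cases hP : P i <;> by_cases hQ : Q (f i) <;> simp [hP, hQ]
  have h2 : ∀ i ∈ S, (if P i then (1 : ℝ≥0∞) else 0) + (if Q i then 1 else 0) =
      (if ¬ (P i ↔ Q i) then (1 : ℝ≥0∞) else 0) := by
    intro i hi
    have := h i hi
    by_cases hP : P i <;> by_cases hQ : Q i <;> simp_all
  have h3 : ∑ i ∈ S, (if Q (f i) then (1 : ℝ≥0∞) else 0) = ∑ i ∈ S, if Q i then 1 else 0 :=
    Finset.sum_nbij f (fun i hi => hf.mapsTo hi) hf.injOn hf.surjOn fun i _ => rfl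
  calc _ ≤ ∑ i ∈ S, ((if P i then (1 : ℝ≥0∞) else 0) + (if Q (f i) then 1 else 0)) :=
        Finset.sum_le_sum fun i _ => h1 i
    _ = ∑ i ∈ S, ((if P i then (1 : ℝ≥0∞) else 0) + (if Q i then 1 else 0)) := by
        rw [Finset.sum_add_distrib, h3, ← Finset.sum_add_distrib]
    _ = _ := Finset.sum_congr rfl h2

/-- Among arcs of equal length no two of which are separated by a great circle, there is one with
an endpoint whose distance from the other endpoints is at most this length. -/
theorem exists_forall_le_inner {ι : Type*} [Finite ι] [Nonempty ι] {v t : ι → E3} {κ : ℝ}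
    (hκ : 0 ≤ κ) (hκ1 : κ < 1) (hv : ∀ i, ‖v i‖ = 1) (ht : ∀ i, ‖t i‖ = 1)
    (hvt : ∀ i, inner ℝ (t i) (v i) = κ) (hanti : ∀ i j, -1 < inner ℝ (t i) (v j))
    (hsep : ∀ (i j : ι) (l : E3), 0 < inner ℝ l (t i) → 0 < inner ℝ l (v i) →
      inner ℝ l (t j) ≤ 0 → inner ℝ l (v j) ≤ 0 → False) :
    ∃ i, ∀ j, κ ≤ inner ℝ (t i) (v j) := by
  classical
  by_contra! hcon
  choose f hf using hcon
  have hfin : (Function.periodicPts f).Finite := Set.toFinite _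
  set S : Finset ι := hfin.toFinset with hS
  have hbij : Set.BijOn f S S := by
    rw [hS, hfin.coe_toFinset]; exact Function.bijOn_periodicPts f
  have hne : S.Nonempty := by
    obtain ⟨x⟩ := ‹Nonempty ι›
    obtain ⟨n, k, hnk, e⟩ := Finite.exists_ne_map_eq_of_infinite fun n : ℕ => f^[n] x
    wlog hlt : n < k generalizing n k
    · exact this k n hnk.symm e.symm (lt_of_le_of_ne (not_lt.mp hlt) hnk.symm)
    refine ⟨f^[n] x, hfin.mem_toFinset.mpr (Function.mk_mem_periodicPts (n := k - n)
      (Nat.sub_pos_of_lt hlt) ?_)⟩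
    change f^[k - n] (f^[n] x) = f^[n] x
    rw [← Function.iterate_add_apply, Nat.sub_add_cancel hlt.le]
    exact e.symm
  have hpt : ∀ u : E3, ∑ i ∈ S, (separating (t i) (v (f i))).indicator (1 : E3 → ℝ≥0∞) u ≤
      ∑ i ∈ S, (separating (t i) (v i)).indicator (1 : E3 → ℝ≥0∞) u := by
    intro u
    by_cases hu : u ∈ Metric.ball (0 : E3) 1
    · have hind : ∀ a b : E3, (separating a b).indicator (1 : E3 → ℝ≥0∞) u =
          if ¬ (0 < inner ℝ u a ↔ 0 < inner ℝ u b) then 1 else 0 := by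
        intro a b
        rw [Set.indicator_apply]
        exact if_congr ⟨fun h => h.2, fun h => ⟨hu, h⟩⟩ rfl rfl
      simp only [hind]
      -- If some arc is strictly on the positive side of `u`, no arc lies in the opposite closed
      -- side; otherwise no arc is strictly positive. Either way one side yields mutually exclusive
      -- `P` and `Q`.
      by_cases hpos : ∃ i, 0 < inner ℝ u (t i) ∧ 0 < inner ℝ u (v i)
      · obtain ⟨i, hi1, hi2⟩ := hpos
        have := sum_not_iff_comp_le (P := fun i => ¬ 0 < inner ℝ u (t i))
          (Q := fun i => ¬ 0 < inner ℝ u (v i)) hbij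
          fun j _ hj => hsep i j u hi1 hi2 (not_lt.mp hj.1) (not_lt.mp hj.2)
        simpa only [not_iff_not] using this
      · push Not at hpos
        exact sum_not_iff_comp_le (P := fun i => 0 < inner ℝ u (t i))
          (Q := fun i => 0 < inner ℝ u (v i)) hbij
          fun j _ hj => (hpos j hj.1).not_gt hj.2
    · have hind : ∀ a b : E3, (separating a b).indicator (1 : E3 → ℝ≥0∞) u = 0 := fun a b =>
        Set.indicator_of_notMem (fun h => hu h.1) _
      simp [hind]
  have hint : ∑ i ∈ S, volume (separating (t i) (v (f i))) ≤
      ∑ i ∈ S, volume (separating (t i) (v i)) := by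
    have hsum : ∀ w : ι → E3, ∑ i ∈ S, volume (separating (t i) (w i)) =
        ∫⁻ u, ∑ i ∈ S, (separating (t i) (w i)).indicator (1 : E3 → ℝ≥0∞) u := by
      intro w
      rw [lintegral_finsetSum _ fun i _ =>
        measurable_one.indicator (measurableSet_separating (t i) (w i))]
      exact Finset.sum_congr rfl fun i _ =>
        (lintegral_indicator_one (measurableSet_separating (t i) (w i))).symm
    rw [hsum (fun i => v (f i)), hsum v]
    exact lintegral_mono hpt
  refine hint.not_gt (ENNReal.sum_lt_sum_of_nonempty hne fun i _ => ?_)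
  refine volume_separating_lt (ht i) (hv i) (ht i) (hv (f i)) ?_ ?_ (hanti _ _) ?_
  · rw [hvt]; exact hκ
  · rw [hvt]; exact hκ1
  · rw [hvt]; exact hf i

/-! ### Vertices of a polygon. -/

theorem inner_eq_one_of_mem_convexHull {F : Finset E3} {m : E3} (hF : ∀ y ∈ F, inner ℝ m y = 1) :
    ∀ y ∈ convexHull ℝ (F : Set E3), inner ℝ m y = 1 := by
  have hconv : Convex ℝ {y : E3 | inner ℝ m y = 1} := by
    intro a ha b hb s t _ _ hst
    simp only [Set.mem_ofPred_eq] at *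
    rw [inner_add_right, inner_smul_right, inner_smul_right, ha, hb]; linarith
  exact fun y hy => convexHull_min (fun y hy => hF y hy) hconv hy

/-- The vertices of a polygon, in the plane `⟪m, ·⟫ = 1`. -/
theorem IsPolygon.exists_vertices {V : Set S2} (hV : IsPolygon V) : ∃ (m : E3) (F : Finset E3),
    F.Nonempty ∧ (∀ y ∈ F, inner ℝ m y = 1) ∧
    (∀ y ∈ F, ∃ x ∈ V, ∃ r : ℝ, 0 < r ∧ (x : E3) = r • y) ∧
    (∀ x ∈ V, ∃ y ∈ convexHull ℝ (F : Set E3), ∃ r : ℝ, 0 < r ∧ (x : E3) = r • y) ∧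
    ∀ y ∈ F, y ∉ convexHull ℝ ((F : Set E3) \ {y}) := by
  classical
  obtain ⟨hbody, F₀, hfin, ⟨m, hm⟩, hhull⟩ := hV
  have hm' : ∀ x ∈ F₀, 0 < inner ℝ (m : E3) (x : E3) := by
    intro x hx
    have := hm x hx
    rwa [sdist_eq, Real.arccos_lt_pi_div_two] at this
  -- Central projection turns spherical convexity into affine convexity.
  let pr : S2 → E3 := fun x => (inner ℝ (m : E3) (x : E3))⁻¹ • (x : E3)
  let G : Finset E3 := hfin.toFinset.image pr
  have hG1 : ∀ y ∈ G, inner ℝ (m : E3) y = 1 := by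
    intro y hy
    obtain ⟨x, hx, rfl⟩ := Finset.mem_image.mp hy
    have := hm' x (hfin.mem_toFinset.mp hx)
    simp only [pr, inner_smul_right]
    exact inv_mul_cancel₀ this.ne'
  have hG2 : ∀ y ∈ G, ∃ x ∈ V, ∃ r : ℝ, 0 < r ∧ (x : E3) = r • y := by
    intro y hy
    obtain ⟨x, hx, rfl⟩ := Finset.mem_image.mp hy
    have hx' := hfin.mem_toFinset.mp hx
    have := hm' x hx'
    refine ⟨x, ?_, _, this, ?_⟩
    · rw [hhull]; exact fun C hC => hC.2 hx'
    · simp only [pr]; rw [smul_smul, mul_inv_cancel₀ this.ne', one_smul]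
  have hplane := inner_eq_one_of_mem_convexHull hG1
  have hG3 : ∀ x ∈ V, ∃ y ∈ convexHull ℝ (G : Set E3), ∃ r : ℝ, 0 < r ∧ (x : E3) = r • y := by
    let C : Set S2 := {x | ∃ y ∈ convexHull ℝ (G : Set E3), ∃ r : ℝ, 0 < r ∧ (x : E3) = r • y}
    have hC : IsConvex C := by
      constructor
      · rintro a ⟨y, hy, r, hr, e⟩ ⟨y', hy', r', hr', e'⟩
        have h1 := congrArg (fun z => inner ℝ (m : E3) z) e
        have h2 := congrArg (fun z => inner ℝ (m : E3) z) e'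
        simp only [inner_smul_right, hplane y hy, hplane y' hy',
          show ((-a : S2) : E3) = -(a : E3) from rfl, inner_neg_right] at h1 h2
        linarith
      · rintro a ⟨y, hy, r, hr, e⟩ b ⟨y', hy', r', hr', e'⟩ x ⟨s, t, hs, ht, ex⟩
        have hst : 0 < s * r + t * r' := by
          have h1 := mul_nonneg hs hr.le
          have h2 := mul_nonneg ht hr'.le
          refine lt_of_le_of_ne (add_nonneg h1 h2) fun h0 => ?_
          have hs0 : s * r = 0 := by linarith
          have ht0 : t * r' = 0 := by linarith
          rw [e, e', smul_smul, smul_smul, hs0, ht0, zero_smul, zero_smul, add_zero] at ex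
          have := inner_self_sphere x
          rw [ex, inner_zero_left] at this
          exact zero_ne_one this
        refine ⟨(s * r / (s * r + t * r')) • y + (t * r' / (s * r + t * r')) • y',
          (convex_convexHull ℝ _) hy hy' (by positivity) (by positivity) (by field_simp),
          _, hst, ?_⟩
        rw [ex, e, e', smul_add, smul_smul, smul_smul, smul_smul, smul_smul,
          mul_div_cancel₀ _ hst.ne', mul_div_cancel₀ _ hst.ne']
    intro x hx
    rw [hhull] at hx
    refine hx C ⟨hC, fun a ha => ⟨pr a, subset_convexHull ℝ _ (Finset.mem_coe.mpr
      (Finset.mem_image_of_mem _ (hfin.mem_toFinset.mpr ha))), _, hm' a ha, ?_⟩⟩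
    simp only [pr]; rw [smul_smul, mul_inv_cancel₀ (hm' a ha).ne', one_smul]
  -- A generating subset of least cardinality has no redundant point.
  obtain ⟨F, hF, hFmin⟩ := (G.powerset.filter fun F : Finset E3 =>
    convexHull ℝ (F : Set E3) = convexHull ℝ (G : Set E3)).exists_min_image Finset.card
    ⟨G, by simp⟩
  obtain ⟨hFG, hFhull⟩ := Finset.mem_filter.mp hF
  rw [Finset.mem_powerset] at hFG
  refine ⟨m, F, ?_, fun y hy => hG1 y (hFG hy), fun y hy => hG2 y (hFG hy), ?_, ?_⟩
  · obtain ⟨x, hx⟩ := hbody.2.2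
    obtain ⟨y, hy, -⟩ := hG3 x (interior_subset hx)
    rw [← hFhull] at hy
    exact Finset.coe_nonempty.mp (convexHull_nonempty_iff.mp ⟨y, hy⟩)
  · rw [hFhull]; exact hG3
  · intro y hy hmem
    have hle : convexHull ℝ ((F.erase y : Finset E3) : Set E3) = convexHull ℝ (F : Set E3) := by
      apply le_antisymm (convexHull_mono (by exact_mod_cast Finset.erase_subset y F))
      refine convexHull_min (fun z hz => ?_) (convex_convexHull ℝ _)
      by_cases hzy : z = y
      · rw [hzy, Finset.coe_erase]; exact hmem
      · exact subset_convexHull ℝ _ (by simpa [hzy] using hz)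
    have := hFmin (F.erase y) (by
      simp only [Finset.mem_filter, Finset.mem_powerset]
      exact ⟨(Finset.erase_subset y F).trans hFG, hle.trans hFhull⟩)
    have := Finset.card_erase_lt_of_mem hy
    omega

/-- Points outside the convex hull of the other ones are strictly exposed. -/
theorem exists_exposing {F : Finset E3} {m y : E3} (hm : ∀ z ∈ F, inner ℝ m z = 1) (hy : y ∈ F)
    (h : y ∉ convexHull ℝ ((F : Set E3) \ {y})) :
    ∃ k : E3, inner ℝ k y = 0 ∧ ∀ z ∈ F, z ≠ y → 0 < inner ℝ k z := by
  have hcl : IsClosed (convexHull ℝ ((F : Set E3) \ {y})) :=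
    (F.finite_toSet.subset Set.sdiff_subset).isClosed_convexHull ℝ
  obtain ⟨f, u, hfy, hf⟩ := geometric_hahn_banach_point_closed (convex_convexHull ℝ _) hcl h
  set a := (InnerProductSpace.toDual ℝ E3).symm f
  have ha : ∀ z, inner ℝ a z = f z := fun z => InnerProductSpace.toDual_symm_apply
  -- On the plane `⟪m, ·⟫ = 1` the constant `f y` is the linear functional `f y • m`.
  refine ⟨a - f y • m, ?_, fun z hz hzy => ?_⟩
  · rw [inner_sub_left, inner_smul_left, ha, hm y hy]; simp
  · rw [inner_sub_left, inner_smul_left, ha, hm z hz]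
    have := hf z (subset_convexHull ℝ _ ⟨hz, hzy⟩)
    simp only [conj_trivial, mul_one]
    linarith

theorem eq_of_smul_eq {x v : S2} {y : E3} {r s : ℝ} (hr : 0 < r) (hs : 0 < s)
    (hx : (x : E3) = r • y) (hv : (v : E3) = s • y) : x = v := by
  have h1 : ‖(x : E3)‖ = 1 := by simp
  have h2 : ‖(v : E3)‖ = 1 := by simp
  rw [hx, norm_smul, Real.norm_of_nonneg hr.le] at h1
  rw [hv, norm_smul, Real.norm_of_nonneg hs.le] at h2
  have hy : ‖y‖ ≠ 0 := by intro h; rw [h, mul_zero] at h1; exact zero_ne_one h1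
  have : r = s := mul_right_cancel₀ hy (h1.trans h2.symm)
  exact Subtype.ext (by rw [hx, hv, this])

/-- A functional exposing a vertex among the vertices exposes it in their convex hull. -/
theorem inner_pos_of_mem_convexHull {F : Finset E3} {k y z : E3} (hky : inner ℝ k y = 0)
    (hk : ∀ z ∈ F, z ≠ y → 0 < inner ℝ k z) (hz : z ∈ convexHull ℝ (F : Set E3)) (hzy : z ≠ y) :
    0 < inner ℝ k z := by
  obtain ⟨w, hw0, hw1, rfl⟩ := Finset.mem_convexHull'.mp hz
  have hterm : ∀ i ∈ F, 0 ≤ w i * inner ℝ k i := by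
    intro i hi
    by_cases hiy : i = y
    · rw [hiy, hky, mul_zero]
    · exact mul_nonneg (hw0 i hi) (hk i hi hiy).le
  simp only [inner_sum, inner_smul_right]
  refine lt_of_le_of_ne (Finset.sum_nonneg hterm) fun h0 => hzy ?_
  have hall := (Finset.sum_eq_zero_iff_of_nonneg hterm).mp h0.symm
  have hw : ∀ i ∈ F, i ≠ y → w i = 0 := fun i hi hiy =>
    (mul_eq_zero.mp (hall i hi)).resolve_right (hk i hi hiy).ne'
  calc ∑ i ∈ F, w i • i = ∑ i ∈ F, w i • y := by
        refine Finset.sum_congr rfl fun i hi => ?_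
        by_cases hiy : i = y
        · rw [hiy]
        · rw [hw i hi hiy, zero_smul, zero_smul]
    _ = y := by rw [← Finset.sum_smul, hw1, one_smul]

/-- At a vertex there is a supporting hemisphere different from a given one. -/
theorem exists_mem_polar_ne_of_vertex {V : Set S2} {F : Finset E3}
    (hV : ∀ x ∈ V, ∃ y ∈ convexHull ℝ (F : Set E3), ∃ r : ℝ, 0 < r ∧ (x : E3) = r • y)
    {k y : E3} (hky : inner ℝ k y = 0) (hk : ∀ z ∈ F, z ≠ y → 0 < inner ℝ k z) (g : S2) :
    ∃ g' ∈ polar V, g' ≠ g ∧ inner ℝ (g' : E3) y = 0 := by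
  -- Tilting `k` by `w` keeps it orthogonal to `y`. As `w` is also orthogonal to `g`, not both `k`
  -- and `k + ε • w` are multiples of `g`.
  obtain ⟨w, hw0, hwy, hwg⟩ := exists_orthogonal y (g : E3)
  have hpos : ∀ᶠ ε in 𝓝[>] (0 : ℝ), ∀ z ∈ F, z ≠ y → 0 < inner ℝ (k + ε • w) z := by
    rw [eventually_all_finset]
    intro z hz
    by_cases hzy : z = y
    · simp [hzy]
    · have hcont : Continuous fun ε : ℝ => inner ℝ (k + ε • w) z := by fun_prop
      have h2 := hcont.tendsto 0
      simp only [zero_smul, add_zero] at h2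
      filter_upwards [(h2.mono_left nhdsWithin_le_nhds).eventually (lt_mem_nhds (hk z hz hzy))]
        with ε hε _ using hε
  obtain ⟨ε, hε, hε0⟩ := (hpos.and self_mem_nhdsWithin).exists
  replace hε0 : (0 : ℝ) < ε := hε0
  have key : ∀ a : E3, inner ℝ a y = 0 → (∀ z ∈ F, z ≠ y → 0 < inner ℝ a z) →
      (∀ r : ℝ, a ≠ r • (g : E3)) → ∃ g' ∈ polar V, g' ≠ g ∧ inner ℝ (g' : E3) y = 0 := by
    intro a hay ha hag
    have ha0 : a ≠ 0 := by simpa using hag 0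
    have hn : 0 < ‖a‖ := norm_pos_iff.mpr ha0
    obtain ⟨g', hg'⟩ := exists_sphere_smul ha0
    refine ⟨g', fun x hx => ?_, fun e => hag ‖a‖ (e ▸ hg'), ?_⟩
    · obtain ⟨z, hz, r, hr, e⟩ := hV x hx
      have h1 : 0 ≤ inner ℝ a z := by
        by_cases hzy : z = y
        · rw [hzy, hay]
        · exact (inner_pos_of_mem_convexHull hay ha hz hzy).le
      rw [hg', inner_smul_left, conj_trivial] at h1
      rw [e, inner_smul_right]
      exact mul_nonneg hr.le (nonneg_of_mul_nonneg_right h1 hn)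
    · rw [hg', inner_smul_left, conj_trivial] at hay
      exact (mul_eq_zero.mp hay).resolve_left hn.ne'
  have hwy' : inner ℝ w y = 0 := by rw [real_inner_comm]; exact hwy
  have hwg' : inner ℝ w (g : E3) = 0 := by rw [real_inner_comm]; exact hwg
  by_cases hkg : ∃ r : ℝ, k = r • (g : E3)
  · obtain ⟨r, hr⟩ := hkg
    refine key (k + ε • w) ?_ hε fun s hs => hw0 ?_
    · rw [inner_add_left, inner_smul_left, hky, hwy']; simp
    · have h1 := congrArg (fun z => inner ℝ w z) hs
      simp only [hr, inner_add_right, inner_smul_right, hwg', mul_zero, zero_add] at h1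
      exact inner_self_eq_zero.mp ((mul_eq_zero.mp h1).resolve_left hε0.ne')
  · push Not at hkg
    exact key k hky hk hkg

/-- The pair of centers of a thinnest lune in terms of inner products. -/
theorem IsFarthestPair.center_spec {V : Set S2} {g h v t : S2} {c : ℝ} (H : IsFarthestPair V g h)
    (hc : inner ℝ (g : E3) (h : E3) = c) (hs : 0 < 1 - c ^ 2)
    (hv : (h : E3) - c • (g : E3) = √(1 - c ^ 2) • (v : E3))
    (ht : (g : E3) - c • (h : E3) = √(1 - c ^ 2) • (t : E3)) :
    inner ℝ (t : E3) (v : E3) = -c ∧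
      (∀ x ∈ V, -c * inner ℝ (v : E3) (x : E3) ≤ inner ℝ (t : E3) (x : E3)) ∧
      (∀ x ∈ V, -c * inner ℝ (t : E3) (x : E3) ≤ inner ℝ (v : E3) (x : E3)) ∧
      inner ℝ (h : E3) (t : E3) = 0 := by
  have hc' : inner ℝ (h : E3) (g : E3) = c := by rw [real_inner_comm, hc]
  set s := √(1 - c ^ 2) with hsd
  have hs0 : 0 < s := Real.sqrt_pos.mpr hs
  have hs2 : s ^ 2 = 1 - c ^ 2 := Real.sq_sqrt hs.le
  have ev : ∀ x : E3, s * inner ℝ (v : E3) x = inner ℝ (h : E3) x - c * inner ℝ (g : E3) x := by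
    intro x
    have := congrArg (fun z => inner ℝ z x) hv
    simp only [inner_sub_left, inner_smul_left, conj_trivial] at this
    exact this.symm
  have et : ∀ x : E3, s * inner ℝ (t : E3) x = inner ℝ (g : E3) x - c * inner ℝ (h : E3) x := by
    intro x
    have := congrArg (fun z => inner ℝ z x) ht
    simp only [inner_sub_left, inner_smul_left, conj_trivial] at this
    exact this.symm
  -- Solving the two relations gives `t + c v = s g` and `v + c t = s h`, so the inequalities
  -- express membership in the hemispheres of `g` and `h`.
  refine ⟨?_, fun x hx => ?_, fun x hx => ?_, ?_⟩
  · have h1 := et (v : E3)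
    have h2 := ev (g : E3)
    have h3 := ev (h : E3)
    rw [inner_self_sphere, hc'] at h2
    rw [inner_self_sphere, hc] at h3
    rw [real_inner_comm] at h2 h3
    have : s ^ 2 * (inner ℝ (t : E3) (v : E3) + c) = 0 := by
      linear_combination s * h1 + h2 - c * h3 + c * hs2
    have := (mul_eq_zero.mp this).resolve_left (by positivity)
    linarith
  · refine le_of_mul_le_mul_left ?_ hs0
    have := mul_nonneg hs.le (H.1 x hx)
    linear_combination this - c * ev (x : E3) - et (x : E3)
  · refine le_of_mul_le_mul_left ?_ hs0
    have := mul_nonneg hs.le (H.2.1 x hx)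
    linear_combination this - c * et (x : E3) - ev (x : E3)
  · have h1 := et (h : E3)
    rw [hc, inner_self_sphere, real_inner_comm] at h1
    exact (mul_eq_zero.mp (h1.trans (by ring))).resolve_left hs0.ne'

end SphericalPolygon

/-! ### The theorem. -/

open SphericalPolygon in
theorem mainTheorem2 (V : Set SphericalPolygon.S2) (hV : SphericalPolygon.IsPolygon V)
    (hred : SphericalPolygon.IsReduced V) :
    SphericalPolygon.thickness V ∈ Set.Ioc 0 (Real.pi / 2) ∧
      ∃ p ∈ frontier V, V ⊆ SphericalPolygon.disk p (SphericalPolygon.thickness V) := by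
  obtain ⟨m, F, hFne, hF1, hFV, hVF, hFext⟩ := hV.exists_vertices
  have hbody : IsConvexBody V := hV.1
  have hplane := inner_eq_one_of_mem_convexHull hF1
  have hm : ∀ x ∈ V, 0 < inner ℝ m (x : E3) := by
    intro x hx
    obtain ⟨z, hz, r, hr, e⟩ := hVF x hx
    rw [e, inner_smul_right, hplane z hz, mul_one]; exact hr
  obtain ⟨g₀, h₀, H₀⟩ := exists_isFarthestPair hbody.2.1 (hbody.2.2.mono interior_subset) hm
  have hlune := H₀.isLunePair hbody.2.1 hbody.2.2 hm
  have hthick := H₀.thickness_eq hbody.2.1 hbody.2.2 hm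
  set c := inner ℝ (g₀ : E3) (h₀ : E3) with hc
  have hc1 : c < 1 := inner_lt_one hlune.1
  have hc2 : -1 < c := neg_one_lt_inner hlune.2
  have hs : 0 < 1 - c ^ 2 := by nlinarith
  have hvert : ∀ y : F, ∃ k : E3, inner ℝ k (y : E3) = 0 ∧
      ∀ z ∈ F, z ≠ y → 0 < inner ℝ k z := fun y => exists_exposing hF1 y.2 (hFext y y.2)
  have hlunes : ∀ y : F, ∃ g h v t : S2, IsFarthestPair V g h ∧ v ∈ V ∧ t ∈ V ∧
      inner ℝ (g : E3) (h : E3) = c ∧ (∃ r : ℝ, 0 < r ∧ (v : E3) = r • (y : E3)) ∧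
      (h : E3) - c • (g : E3) = √(1 - c ^ 2) • (v : E3) ∧
      (g : E3) - c • (h : E3) = √(1 - c ^ 2) • (t : E3) := by
    intro y
    obtain ⟨k, hky, hk⟩ := hvert y
    obtain ⟨v, hv, r, hr, e⟩ := hFV y y.2
    obtain ⟨g, h, t, H, ht, e1, e2⟩ := hred.exists_lune hm hv (k := k)
      (by rw [e, inner_smul_right, hky, mul_zero]) (by
        intro x hx hxv
        obtain ⟨z, hz, s, hs, e'⟩ := hVF x hx
        rw [e', inner_smul_right]
        refine mul_pos hs (inner_pos_of_mem_convexHull hky hk hz ?_)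
        rintro rfl
        exact hxv (eq_of_smul_eq hs hr e' e))
    have hcc : inner ℝ (g : E3) (h : E3) = c :=
      le_antisymm (H.2.2 g₀ H₀.1 h₀ H₀.2.1) (H₀.2.2 g H.1 h H.2.1)
    rw [hcc] at e1 e2
    exact ⟨g, h, v, t, H, hv, ht, hcc, ⟨r, hr, e⟩, e1, e2⟩
  -- If `c > 0`, a second hemisphere `g'` supporting at the vertex gives `⟪g', h⟫ = c * ⟪g', g⟫ <
  -- c`, against the minimality of `c`.
  have hc0 : c ≤ 0 := by
    by_contra! hpos
    obtain ⟨y₀, hy₀⟩ := hFne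
    obtain ⟨k, hky, hk⟩ := hvert ⟨y₀, hy₀⟩
    obtain ⟨g, h, v, t, H, hv, ht, hcc, ⟨r, hr, e⟩, e1, e2⟩ := hlunes ⟨y₀, hy₀⟩
    obtain ⟨g', hg', hne, hgy⟩ := exists_mem_polar_ne_of_vertex hVF hky hk g
    have h1 := congrArg (fun z => inner ℝ (g' : E3) z) e1
    simp only [inner_sub_right, inner_smul_right, e, hgy, mul_zero] at h1
    have h2 := H₀.2.2 g' hg' h H.2.1
    have h3 := inner_lt_one hne
    nlinarith
  choose g h v t H hvV htV hcc hvy e1 e2 using hlunes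
  have hspec := fun y : F => (H y).center_spec (hcc y) hs (e1 y) (e2 y)
  have : Nonempty F := hFne.to_subtype
  obtain ⟨i, hi⟩ := exists_forall_le_inner (v := fun y : F => (v y : E3))
    (t := fun y : F => (t y : E3)) (κ := -c) (by linarith) (by linarith) (fun _ => by simp)
    (fun _ => by simp) (fun y => (hspec y).1)
    (fun y z => neg_one_lt_inner fun heq => hbody.1.1 (v z) (hvV z) (heq ▸ htV y))
    (by
      intro y z l l1 l2 l3 l4
      obtain ⟨a1, a2, a3, -⟩ := hspec y
      obtain ⟨b1, b2, b3, -⟩ := hspec z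
      refine not_separated (v := (v y : E3)) (t := (t y : E3)) (u := (v z : E3))
        (y := (t z : E3)) (m := m) (l := l) (κ := -c) (by linarith) (by linarith)
        (inner_self_sphere _) (inner_self_sphere _) (inner_self_sphere _) (inner_self_sphere _)
        (by rw [real_inner_comm]; exact a1) (by rw [real_inner_comm]; exact b1)
        (hm _ (hvV y)) (hm _ (htV y)) (hm _ (hvV z)) (hm _ (htV z))
        (a2 _ (hvV z)) (a2 _ (htV z)) (a3 _ (hvV z)) (a3 _ (htV z)) ?_ ?_ ?_ ?_ l2 l1 l4 l3
      · simpa only [real_inner_comm] using b2 _ (hvV y)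
      · simpa only [real_inner_comm] using b2 _ (htV y)
      · simpa only [real_inner_comm] using b3 _ (hvV y)
      · simpa only [real_inner_comm] using b3 _ (htV y))
  rw [← Real.arccos_neg] at hthick
  rw [hthick]
  refine ⟨⟨Real.arccos_pos.mpr (by linarith), Real.arccos_le_pi_div_two.mpr (by linarith)⟩,
    t i, ⟨subset_closure (htV i), notMem_interior (H i).2.1 (hspec i).2.2.2⟩, fun x hx => ?_⟩
  change sdist (t i) x ≤ _
  rw [sdist_eq]
  refine Real.arccos_le_arccos ?_
  -- The cone over the disk around `t i`; its convexity rests on `0 ≤ -c` and reduces the inclusion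
  -- to the vertices.
  have hconv : Convex ℝ {z : E3 | -c * ‖z‖ ≤ inner ℝ (t i : E3) z} := by
    intro a ha b hb s r hs0 hr0 _
    simp only [Set.mem_ofPred_eq] at *
    rw [inner_add_right, inner_smul_right, inner_smul_right]
    have h1 : ‖s • a + r • b‖ ≤ s * ‖a‖ + r * ‖b‖ := by
      simpa [norm_smul, abs_of_nonneg hs0, abs_of_nonneg hr0] using norm_add_le (s • a) (r • b)
    have h2 := mul_le_mul_of_nonneg_left h1 (by linarith : 0 ≤ -c)
    have h3 := mul_le_mul_of_nonneg_left ha hs0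
    have h4 := mul_le_mul_of_nonneg_left hb hr0
    linarith
  have hsub : (F : Set E3) ⊆ {z : E3 | -c * ‖z‖ ≤ inner ℝ (t i : E3) z} := by
    intro z hz
    obtain ⟨r, hr, e⟩ := hvy ⟨z, hz⟩
    have h1 := hi ⟨z, hz⟩
    have h2 : ‖(v ⟨z, hz⟩ : E3)‖ = 1 := by simp
    simp only [e, inner_smul_right, norm_smul, Real.norm_of_nonneg hr.le] at h1 h2
    refine le_of_mul_le_mul_left ?_ hr
    linear_combination h1 - c * h2
  obtain ⟨z, hz, r, hr, e⟩ := hVF x hx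
  have h1 : -c * ‖z‖ ≤ inner ℝ (t i : E3) z := convexHull_min hsub hconv hz
  have h2 : ‖(x : E3)‖ = 1 := by simp
  rw [e, norm_smul, Real.norm_of_nonneg hr.le] at h2
  rw [e, inner_smul_right]
  linear_combination mul_le_mul_of_nonneg_left h1 hr.le + c * h2
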